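/- Let $P^{\otimes 4}=\mathbb Z/2[t_1,t_2,t_3,t_4]$ with each $t_i$ of degree one, let $P^{\otimes 4}_{n}$ be its homogeneous part of degree $n$, and let the Steenrod squares $Sq^k$ act on it by the Cartan formula together with $Sq^0(t_i)=t_i$, $Sq^1(t_i)=t_i^2$ and $Sq^k(t_i)=0$ for $k>1$. The dual space $[P^{\otimes 4}_{n}]^*$ (the mod $2$ homology of $(\mathbb{RP}^\infty)^4$ in degree $n$) has the basis of divided power monomials $x_1^{(a_1)}x_2^{(a_2)}x_3^{(a_3)}x_4^{(a_4)}$ with $a_1+a_2+a_3+a_4=n$, dual to the monomials $t_1^{a_1}t_2^{a_2}t_3^{a_3}t_4^{a_4}$. It carries the dual right action of the squares, $((\varphi)Sq^k)(f)=\varphi(Sq^k f)$ for $f\in P^{\otimes 4}_{n-k}$, and the action of $GL_4=GL_4(\mathbb Z/2)$ dual to linear substitution of the variables. Let ${\rm Ann}_{\overline{\mathcal A}}[P^{\otimes 4}_{n}]^*$ be the $GL_4$-submodule of those elements $\varphi$ with $(\varphi)Sq^k=0$ for all $k>0$. For a $GL_4$-module $M$ over $\mathbb Z/2$, let $\mathbb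 Z/2\otimes_{GL_4}M$ denote the space of coinvariants, that is, the quotient of $M$ by the span of all $gm-m$ with $g\in GL_4$ and $m\in M$; the class of $m$ in it is written $[m]$. Let $n_3=5\cdot 2^3-2=38$ and let $\widetilde\zeta\in[P^{\otimes 4}_{38}]^*$ be the following sum of $44$ monomials: $$\begin{aligned} \widetilde\zeta ={}& x_1^{(11)}x_2^{(11)}x_3^{(11)}x_4^{(5)} + x_1^{(11)}x_2^{(11)}x_3^{(13)}x_4^{(3)} + x_1^{(7)}x_2^{(11)}x_3^{(17)}x_4^{(3)} + x_1^{(11)}x_2^{(7)}x_3^{(17)}x_4^{(3)} \\ &+ x_1^{(7)}x_2^{(13)}x_3^{(15)}x_4^{(3)} + x_1^{(11)}x_2^{(15)}x_3^{(9)}x_4^{(3)} + x_1^{(15)}x_2^{(11)}x_3^{(9)}x_4^{(3)} + x_1^{(7)}x_2^{(19)}x_3^{(9)}x_4^{(3)} \\ &+ x_1^{(19)}x_2^{(7)}x_3^{(9)}x_4^{(3)} + x_1^{(7)}x_2^{(19)}x_3^{(7)}x_4^{(5)} + x_1^{(19)}x_2^{(7)}x_3^{(7)}x_4^{(5)} +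 x_1^{(11)}x_2^{(19)}x_3^{(5)}x_4^{(3)} \\ &+ x_1^{(19)}x_2^{(11)}x_3^{(5)}x_4^{(3)} + x_1^{(11)}x_2^{(21)}x_3^{(3)}x_4^{(3)} + x_1^{(19)}x_2^{(13)}x_3^{(3)}x_4^{(3)} + x_1^{(7)}x_2^{(23)}x_3^{(5)}x_4^{(3)} \\ &+ x_1^{(23)}x_2^{(7)}x_3^{(5)}x_4^{(3)} + x_1^{(11)}x_2^{(11)}x_3^{(7)}x_4^{(9)} + x_1^{(11)}x_2^{(7)}x_3^{(11)}x_4^{(9)} + x_1^{(7)}x_2^{(11)}x_3^{(11)}x_4^{(9)} \\ &+ x_1^{(7)}x_2^{(25)}x_3^{(3)}x_4^{(3)} + x_1^{(23)}x_2^{(9)}x_3^{(3)}x_4^{(3)} + x_1^{(15)}x_2^{(17)}x_3^{(3)}x_4^{(3)} + x_1^{(15)}x_2^{(15)}x_3^{(3)}x_4^{(5)} \\ &+ x_1^{(27)}x_2^{(5)}x_3^{(3)}x_4^{(3)} + x_1^{(29)}x_2^{(3)}x_3^{(3)}x_4^{(3)} + x_1^{(13)}x_2^{(11)}x_3^{(7)}x_4^{(7)}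 + x_1^{(11)}x_2^{(7)}x_3^{(13)}x_4^{(7)} \\ &+ x_1^{(7)}x_2^{(13)}x_3^{(11)}x_4^{(7)} + x_1^{(13)}x_2^{(7)}x_3^{(7)}x_4^{(11)} + x_1^{(7)}x_2^{(7)}x_3^{(13)}x_4^{(11)} + x_1^{(7)}x_2^{(13)}x_3^{(7)}x_4^{(11)} \\ &+ x_1^{(11)}x_2^{(7)}x_3^{(7)}x_4^{(13)} + x_1^{(7)}x_2^{(11)}x_3^{(7)}x_4^{(13)} + x_1^{(7)}x_2^{(7)}x_3^{(11)}x_4^{(13)} + x_1^{(7)}x_2^{(7)}x_3^{(7)}x_4^{(17)} \\ &+ x_1^{(7)}x_2^{(7)}x_3^{(9)}x_4^{(15)} + x_1^{(7)}x_2^{(11)}x_3^{(5)}x_4^{(15)} + x_1^{(7)}x_2^{(13)}x_3^{(3)}x_4^{(15)} + x_1^{(7)}x_2^{(7)}x_3^{(19)}x_4^{(5)} \\ &+ x_1^{(7)}x_2^{(7)}x_3^{(21)}x_4^{(3)} + x_1^{(11)}x_2^{(7)}x_3^{(15)}x_4^{(5)} + x_1^{(11)}x_2^{(15)}x_3^{(7)}x_4^{(5)}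 + x_1^{(15)}x_2^{(11)}x_3^{(7)}x_4^{(5)}. \end{aligned}$$ **Theorem.** The elements $x_1^{(0)}x_2^{(0)}x_3^{(7)}x_4^{(31)}$ and $\widetilde\zeta$ belong to ${\rm Ann}_{\overline{\mathcal A}}[P^{\otimes 4}_{38}]^*$, and the space of coinvariants $\mathbb Z/2\otimes_{GL_4}{\rm Ann}_{\overline{\mathcal A}}[P^{\otimes 4}_{38}]^*$ has dimension $2$ over $\mathbb Z/2$, with basis $\{[x_1^{(0)}x_2^{(0)}x_3^{(7)}x_4^{(31)}],\ [\widetilde\zeta]\}$. -/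

import Mathlib

noncomputable section

namespace SteenrodHomology

/-- The polynomial algebra `P^{⊗h} = (ℤ/2)[t_1, …, t_h]`, the mod 2 cohomology of `BV_h`. -/
abbrev Poly (h : ℕ) : Type := MvPolynomial (Fin h) (ZMod 2)

/-- `P^{⊗h}_n`: the homogeneous polynomials of degree `n`. -/
abbrev PolyDeg (h n : ℕ) : Submodule (ZMod 2) (Poly h) :=
  MvPolynomial.homogeneousSubmodule (Fin h) (ZMod 2) n

/-- `[P^{⊗h}_n]^*`, the mod 2 homology of `BV_h` in degree `n`. -/
abbrev HomologyDeg (h n : ℕ) : Type := Module.Dual (ZMod 2) (PolyDeg h n)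

/-- The total Steenrod square `f ↦ ∑ k, Sq^k(f) T^k`. It is multiplicative (Cartan formula) and
sends each `t_j` to `t_j + t_j ^ 2 T` (instability), which determines it. -/
def totalSq (h : ℕ) : Poly h →ₐ[ZMod 2] Polynomial (Poly h) :=
  MvPolynomial.aeval fun j =>
    Polynomial.C (MvPolynomial.X j) + Polynomial.C (MvPolynomial.X j ^ 2) * Polynomial.X

/-- The Steenrod square `Sq^k` on `P^{⊗h}`. -/
def steenrodSq (h k : ℕ) : Poly h →ₗ[ZMod 2] Poly h where
  toFun f := (totalSq h f).coeff k
  map_add' f g := by simp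
  map_smul' c f := by simp

theorem steenrodSq_isHomogeneous {h m : ℕ} (k : ℕ) {f : Poly h} (hf : f.IsHomogeneous m) :
    (steenrodSq h k f).IsHomogeneous (m + k) := by
  have key : ∀ s : Fin h →₀ ℕ, ∀ k : ℕ,
      ((totalSq h (MvPolynomial.monomial s 1)).coeff k).IsHomogeneous (s.degree + k) := by
    intro s
    induction s using Finsupp.induction_linear with
    | zero =>
      intro k
      have h1 : (MvPolynomial.monomial (0 : Fin h →₀ ℕ) (1 : ZMod 2)) = 1 := rfl
      rw [h1, map_one, Polynomial.coeff_one]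
      split_ifs with hk
      · subst hk
        simpa using MvPolynomial.isHomogeneous_one (Fin h) (ZMod 2)
      · exact MvPolynomial.isHomogeneous_zero _ _ _
    | add a b ha hb =>
      intro k
      have hmul : MvPolynomial.monomial (a + b) (1 : ZMod 2)
          = MvPolynomial.monomial a 1 * MvPolynomial.monomial b 1 := by
        simp [MvPolynomial.monomial_mul]
      rw [hmul, map_mul, Polynomial.coeff_mul]
      refine MvPolynomial.IsHomogeneous.sum _ _ _ fun p hp => ?_
      have hk := Finset.HasAntidiagonal.mem_antidiagonal.1 hp
      have := (ha p.1).mul (hb p.2)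
      have e : a.degree + p.1 + (b.degree + p.2) = (a + b).degree + k := by
        rw [map_add]; omega
      rwa [e] at this
    | single i n =>
      induction n with
      | zero =>
        intro k
        have h1 : (MvPolynomial.monomial (Finsupp.single i 0) (1 : ZMod 2)) = 1 := by simp
        rw [h1, map_one, Polynomial.coeff_one]
        split_ifs with hk
        · subst hk
          simpa using MvPolynomial.isHomogeneous_one (Fin h) (ZMod 2)
        · exact MvPolynomial.isHomogeneous_zero _ _ _
      | succ n ih =>
        intro k
        have hmul : MvPolynomial.monomial (Finsupp.single i (n + 1)) (1 : ZMod 2)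
            = MvPolynomial.monomial (Finsupp.single i n) 1 * MvPolynomial.X i := by
          rw [MvPolynomial.X, MvPolynomial.monomial_mul, ← Finsupp.single_add, one_mul]
        rw [hmul, map_mul]
        have hX : totalSq h (MvPolynomial.X i) = Polynomial.C (MvPolynomial.X i)
            + Polynomial.C (MvPolynomial.X i ^ 2) * Polynomial.X := by
          simp [totalSq]
        rw [hX, mul_add, Polynomial.coeff_add, Polynomial.coeff_mul_C, ← mul_assoc]
        have d1 : (Finsupp.single i n).degree = n := by simp
        have d2 : (Finsupp.single i (n + 1)).degree = n + 1 := by simp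
        refine MvPolynomial.IsHomogeneous.add ?_ ?_
        · have := (ih k).mul (MvPolynomial.isHomogeneous_X (ZMod 2) i)
          rw [d1] at this
          rw [d2]
          convert this using 1
          omega
        · cases k with
          | zero => simpa using MvPolynomial.isHomogeneous_zero _ _ _
          | succ k =>
            rw [Polynomial.coeff_mul_X, Polynomial.coeff_mul_C]
            have := (ih k).mul (MvPolynomial.isHomogeneous_X_pow (R := ZMod 2) i 2)
            rw [d1] at this
            rw [d2]
            convert this using 1
            omega
  rw [f.as_sum, map_sum]
  refine MvPolynomial.IsHomogeneous.sum _ _ _ fun s hs => ?_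
  have hdeg : s.degree = m := by
    by_contra hne
    exact (MvPolynomial.mem_support_iff.1 hs) (hf.coeff_eq_zero hne)
  have hsm : MvPolynomial.monomial s (f.coeff s)
      = f.coeff s • MvPolynomial.monomial s (1 : ZMod 2) := by
    simp [MvPolynomial.smul_monomial]
  rw [hsm, map_smul, ← hdeg]
  exact (PolyDeg h (s.degree + k)).smul_mem _ (key s k)

/-- `Sq^k : P^{⊗h}_m → P^{⊗h}_n` for `m + k = n`. -/
def sqDeg (h : ℕ) {m k n : ℕ} (e : m + k = n) : PolyDeg h m →ₗ[ZMod 2] PolyDeg h n :=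
  (steenrodSq h k).restrict fun f hf => by
    subst e
    exact steenrodSq_isHomogeneous k hf

/-- The right action `φ ↦ (φ) Sq^k` from degree `n = m + k` to degree `m` of the homology, dual to
the action of `Sq^k` on polynomials. -/
def homologySq (h : ℕ) {m k n : ℕ} (e : m + k = n) : HomologyDeg h n →ₗ[ZMod 2] HomologyDeg h m :=
  (sqDeg h e).dualMap

/-- `Ann_{Ā} [P^{⊗h}_n]^*`: the homology classes of degree `n` that are sent to zero by every
Steenrod square of positive degree (`m` is the degree of the target). These squares generate the
augmentation ideal `Ā`. -/
def annihilated (h n : ℕ) : Submodule (ZMod 2) (HomologyDeg h n) where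
  carrier := {φ | ∀ (m k : ℕ) (e : m + k = n), 0 < k → homologySq h e φ = 0}
  zero_mem' := fun m k e _ => map_zero _
  add_mem' := fun ha hb m k e hk => by rw [map_add, ha m k e hk, hb m k e hk, add_zero]
  smul_mem' := fun c φ ha m k e hk => by rw [map_smul, ha m k e hk, smul_zero]

/-- The right action of a matrix on polynomials by linear substitution
`(f · g)(t) = f(g t)`, that is `t_j ↦ ∑ i, g_{ji} t_i`. -/
def subst (h : ℕ) (g : Matrix (Fin h) (Fin h) (ZMod 2)) : Poly h →ₐ[ZMod 2] Poly h :=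
  MvPolynomial.aeval fun j => ∑ i, MvPolynomial.C (g j i) * MvPolynomial.X i

theorem subst_one (h : ℕ) : subst h 1 = AlgHom.id (ZMod 2) (Poly h) := by
  ext1 j
  simp [subst, Matrix.one_apply]

theorem subst_mul (h : ℕ) (a b : Matrix (Fin h) (Fin h) (ZMod 2)) :
    subst h (a * b) = (subst h b).comp (subst h a) := by
  ext1 j
  simp only [subst, MvPolynomial.aeval_X, AlgHom.comp_apply, map_sum, map_mul,
    MvPolynomial.algHom_C, MvPolynomial.algebraMap_eq, Matrix.mul_apply, Finset.sum_mul,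
    Finset.mul_sum]
  rw [Finset.sum_comm]
  simp only [mul_assoc]

theorem subst_isHomogeneous {h n : ℕ} (g : Matrix (Fin h) (Fin h) (ZMod 2)) {f : Poly h}
    (hf : f.IsHomogeneous n) : (subst h g f).IsHomogeneous n := by
  have := hf.aeval (fun j => ∑ i, MvPolynomial.C (g j i) * MvPolynomial.X i) (n := 1)
    fun j => MvPolynomial.IsHomogeneous.sum _ _ _ fun i _ =>
      MvPolynomial.isHomogeneous_C_mul_X _ _
  simpa [subst] using this

theorem totalSq_subst (h : ℕ) (g : Matrix (Fin h) (Fin h) (ZMod 2)) (f : Poly h) :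
    totalSq h (subst h g f) = (totalSq h f).map (subst h g : Poly h →+* Poly h) := by
  have key : (totalSq h).comp (subst h g)
      = (Polynomial.mapAlgHom (subst h g)).comp (totalSq h) := by
    ext1 j
    have hC : ∀ c : ZMod 2, totalSq h (MvPolynomial.C c) = Polynomial.C (MvPolynomial.C c) :=
      fun c => by simp [totalSq, Polynomial.algebraMap_apply]
    have hX : ∀ i, totalSq h (MvPolynomial.X i) = Polynomial.C (MvPolynomial.X i)
        + Polynomial.C (MvPolynomial.X i ^ 2) * Polynomial.X := fun i => by simp [totalSq]
    have hs : subst h g (MvPolynomial.X j)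
        = ∑ i, MvPolynomial.C (g j i) * MvPolynomial.X i := by simp [subst]
    have hsq : (∑ i, Polynomial.C (MvPolynomial.C (g j i)) * Polynomial.C (MvPolynomial.X i) :
        Polynomial (Poly h)) ^ 2
        = ∑ i, Polynomial.C (MvPolynomial.C (g j i)) * Polynomial.C (MvPolynomial.X i) ^ 2 := by
      rw [sum_pow_char 2]
      refine Finset.sum_congr rfl fun i _ => ?_
      rw [mul_pow, ← map_pow, ← map_pow, ZMod.pow_card]
    simp only [AlgHom.comp_apply, hX, hs, map_sum, map_mul, map_add, hC, map_pow,
      Polynomial.coe_mapAlgHom, Polynomial.map_C, Polynomial.map_X, RingHom.coe_coe, hsq,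
      mul_add, Finset.sum_add_distrib, Finset.sum_mul, mul_assoc]
  exact DFunLike.congr_fun key f

theorem steenrodSq_subst (h k : ℕ) (g : Matrix (Fin h) (Fin h) (ZMod 2)) (f : Poly h) :
    steenrodSq h k (subst h g f) = subst h g (steenrodSq h k f) := by
  simp [steenrodSq, totalSq_subst, Polynomial.coeff_map]

/-- Linear substitution on `P^{⊗h}_n`. -/
def substDeg (h n : ℕ) (g : Matrix (Fin h) (Fin h) (ZMod 2)) :
    PolyDeg h n →ₗ[ZMod 2] PolyDeg h n :=
  (subst h g).toLinearMap.restrict fun _ hf => subst_isHomogeneous g hf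

/-- The representation of `GL_h = GL_h(ℤ/2)` on `[P^{⊗h}_n]^*` that is dual to the right action on
polynomials: `(g φ)(f) = φ(f · g)`. -/
def homologyRep (h n : ℕ) :
    Representation (ZMod 2) (Matrix.GeneralLinearGroup (Fin h) (ZMod 2)) (HomologyDeg h n) where
  toFun g := (substDeg h n g.1).dualMap
  map_one' := by
    ext φ f
    exact congrArg φ (Subtype.ext (DFunLike.congr_fun (subst_one h) f.1))
  map_mul' a b := by
    ext φ f
    exact congrArg φ (Subtype.ext (DFunLike.congr_fun (subst_mul h a.1 b.1) f.1))

theorem annihilated_le_comap (h n : ℕ) (g : Matrix.GeneralLinearGroup (Fin h) (ZMod 2)) :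
    annihilated h n ≤ (annihilated h n).comap (homologyRep h n g) := by
  intro φ hφ m k e hk
  ext f
  have h1 := DFunLike.congr_fun (hφ m k e hk) (substDeg h m g.1 f)
  have h2 : substDeg h n g.1 (sqDeg h e f) = sqDeg h e (substDeg h m g.1 f) :=
    Subtype.ext (steenrodSq_subst h k g.1 f.1).symm
  change φ (substDeg h n g.1 (sqDeg h e f)) = 0
  rw [h2]
  exact h1

/-- The representation of `GL_h` on `Ann_{Ā} [P^{⊗h}_n]^*`. -/
def annihilatedRep (h n : ℕ) :
    Representation (ZMod 2) (Matrix.GeneralLinearGroup (Fin h) (ZMod 2)) (annihilated h n) :=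
  (homologyRep h n).subrepresentation (annihilated h n) (annihilated_le_comap h n)

/-- The space of coinvariants `ℤ/2 ⊗_{GL_h} Ann_{Ā} [P^{⊗h}_n]^*`. -/
abbrev AnnCoinvariants (h n : ℕ) : Type := (annihilatedRep h n).Coinvariants

/-- The class `[ζ]` in the coinvariants of an `Ā`-annihilated element `ζ`. -/
def annClass (h n : ℕ) (ζ : HomologyDeg h n) (hζ : ζ ∈ annihilated h n) : AnnCoinvariants h n :=
  Representation.Coinvariants.mk (annihilatedRep h n) ⟨ζ, hζ⟩

/-- The divided power monomial `x_1^{(a_1)} ⋯ x_h^{(a_h)}` in degree `n = a_1 + ⋯ + a_h`: the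
element dual to `t_1^{a_1} ⋯ t_h^{a_h}` with respect to the basis of monomials. -/
def dpMonomial (h n : ℕ) (a : Fin h → ℕ) : HomologyDeg h n :=
  (MvPolynomial.lcoeff (ZMod 2) (Finsupp.equivFunOnFinite.symm a)).comp (PolyDeg h n).subtype

/-- The exponents `(a_1, a_2, a_3, a_4)` of the 44 terms of `zetaTilde`. -/
def zetaExponents : List (Fin 4 → ℕ) :=
  [![11, 11, 11, 5], ![11, 11, 13, 3], ![7, 11, 17, 3], ![11, 7, 17, 3],
    ![7, 13, 15, 3], ![11, 15, 9, 3], ![15, 11, 9, 3], ![7, 19, 9, 3],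
    ![19, 7, 9, 3], ![7, 19, 7, 5], ![19, 7, 7, 5], ![11, 19, 5, 3],
    ![19, 11, 5, 3], ![11, 21, 3, 3], ![19, 13, 3, 3], ![7, 23, 5, 3],
    ![23, 7, 5, 3], ![11, 11, 7, 9], ![11, 7, 11, 9], ![7, 11, 11, 9],
    ![7, 25, 3, 3], ![23, 9, 3, 3], ![15, 17, 3, 3], ![15, 15, 3, 5],
    ![27, 5, 3, 3], ![29, 3, 3, 3], ![13, 11, 7, 7], ![11, 7, 13, 7],
    ![7, 13, 11, 7], ![13, 7, 7, 11], ![7, 7, 13, 11], ![7, 13, 7, 11],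
    ![11, 7, 7, 13], ![7, 11, 7, 13], ![7, 7, 11, 13], ![7, 7, 7, 17],
    ![7, 7, 9, 15], ![7, 11, 5, 15], ![7, 13, 3, 15], ![7, 7, 19, 5],
    ![7, 7, 21, 3], ![11, 7, 15, 5], ![11, 15, 7, 5], ![15, 11, 7, 5]]

/-- The element `ζ̃` of `[P^{⊗4}_{38}]^*`. -/
def zetaTilde : HomologyDeg 4 38 :=
  (zetaExponents.map (dpMonomial 4 38)).sum

end SteenrodHomology

end

/-!
The theorem compares two descriptions of `Ann = Ann_{Ā} [P^{⊗4}_{38}]^*`, which has dimension 192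
over `ℤ/2`: one by values on monomials and one by generators of the `GL_4`-module.

*Values on monomials.* A class `φ` is annihilated if and only if it vanishes on all `Sq^k (t^b)`
with `k > 0`. If `φ` is known to vanish on all terms of `Sq^k (t^b)` but one, then `φ` vanishes on
the remaining term as well. When this is iterated ("peeling") with `Sq^1`, `Sq^2`, `Sq^4` and
`Sq^8`, starting from the 192 monomials of `basisExponents`, it reaches every monomial of degree 38.
So an annihilated class that vanishes on these 192 monomials is zero (`eq_zero_of_basisExponents`).

*Generators.* The classes `x_1^{(0)} x_2^{(0)} x_3^{(7)} x_4^{(31)}` and `ζ̃` are annihilated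
(`spike_mem`, `zetaTilde_mem`). Products of elementary transvections move them to further
annihilated classes, and Gaussian elimination shows that the values of these on the 192 monomials
have rank 192. Hence the orbits of the two classes span `Ann` (`annihilated_le_span`), and the
coinvariants are spanned by the two classes (`span_annClass_eq_top`).

*Independence.* For a polynomial `f` of degree 38, evaluation at `f` descends to the coinvariants of
`Ann` as soon as all elements of `Ann` vanish on `f · g - f` for the elementary transvections `g`,
because these generate `GL_4(ℤ/2)`; it suffices to test this on the spanning set found before. This
applies to the two polynomials with exponents `spikeDualExponents` and `zetaDualExponents`, whose
values on the two classes form the identity matrix (`linearIndependent_annClass`).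

The finite computations are evaluated in the kernel. For this a set of monomials of degree 38, or
the list of the values of a class on them, is encoded as a natural number whose binary digits are
indexed by the monomials (`code`, `Represents`). In this code multiplication of all monomials by a
monomial is a shift, so that a Steenrod square or a transvection acts on all monomials at once
through a few shifts and bitwise operations. The number of a variable in the code runs from `0` to
`3`, as in `Fin 4`.
-/

namespace SteenrodHomology

open MvPolynomial

/-! ### Homology classes as functionals on polynomials -/

/-- The monomial `t^a`. -/
noncomputable def mon {h : ℕ} (a : Fin h → ℕ) : Poly h :=
  monomial (Finsupp.equivFunOnFinite.symm a) 1

theorem mon_eq_prod {h : ℕ} (a : Fin h → ℕ) : mon a = ∏ i, (X i : Poly h) ^ a i := by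
  rw [mon, monomial_eq, map_one, one_mul, Finsupp.prod_fintype _ _ (fun i => pow_zero _)]
  rfl

theorem mon_mem {h n : ℕ} {a : Fin h → ℕ} (ha : ∑ i, a i = n) : mon a ∈ PolyDeg h n := by
  refine isHomogeneous_monomial _ ?_
  rw [Finsupp.degree_eq_sum]
  exact ha

/-- A homology class of degree `n`, extended by zero to the polynomials of the other degrees. -/
noncomputable def ext {h n : ℕ} (φ : HomologyDeg h n) : Poly h →ₗ[ZMod 2] ZMod 2 :=
  φ ∘ₗ (homogeneousComponent n).codRestrict _ (homogeneousComponent_mem n)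

theorem ext_apply {h n : ℕ} (φ : HomologyDeg h n) {f : Poly h} (hf : f ∈ PolyDeg h n) :
    ext φ f = φ ⟨f, hf⟩ := by
  refine congrArg φ (Subtype.ext ?_)
  exact homogeneousComponent_of_mem hf |>.trans (if_pos rfl)

theorem ext_coe {h n : ℕ} (φ : HomologyDeg h n) (f : PolyDeg h n) : ext φ f = φ f :=
  ext_apply φ f.2

theorem ext_sub {h n : ℕ} (φ ψ : HomologyDeg h n) (f : Poly h) :
    ext (φ - ψ) f = ext φ f - ext ψ f := rfl

theorem ext_add {h n : ℕ} (φ ψ : HomologyDeg h n) (f : Poly h) :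
    ext (φ + ψ) f = ext φ f + ext ψ f := rfl

theorem ext_smul {h n : ℕ} (c : ZMod 2) (φ : HomologyDeg h n) (f : Poly h) :
    ext (c • φ) f = c * ext φ f := rfl

theorem mem_span_mon {h n : ℕ} {f : Poly h} (hf : f ∈ PolyDeg h n) :
    f ∈ Submodule.span (ZMod 2) (mon '' {a : Fin h → ℕ | ∑ i, a i = n}) := by
  rw [f.as_sum]
  refine Submodule.sum_mem _ fun s hs => ?_
  have h1 : monomial s (f.coeff s) = f.coeff s • mon (h := h) s := by
    rw [mon, smul_monomial, smul_eq_mul, mul_one]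
    rw [show Finsupp.equivFunOnFinite.symm ⇑s = s from Finsupp.ext fun _ => rfl]
  rw [h1]
  refine Submodule.smul_mem _ _ (Submodule.subset_span ⟨s, ?_, rfl⟩)
  rw [Set.mem_ofPred_eq, ← Finsupp.degree_eq_sum]
  by_contra hne
  exact mem_support_iff.1 hs (hf.coeff_eq_zero hne)

theorem eq_zero_of_ext {h n : ℕ} {φ : HomologyDeg h n}
    (H : ∀ a : Fin h → ℕ, ∑ i, a i = n → ext φ (mon a) = 0) : φ = 0 := by
  ext f
  rw [LinearMap.zero_apply, ← ext_coe]
  refine Submodule.span_induction (p := fun f _ => ext φ f = 0) ?_ (map_zero _) ?_ ?_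
    (mem_span_mon f.2)
  · rintro _ ⟨a, ha, rfl⟩
    exact H a ha
  · intro x y _ _ hx hy
    rw [map_add, hx, hy, add_zero]
  · intro c x _ hx
    rw [map_smul, hx, smul_zero]

theorem ext_dpMonomial {h n : ℕ} (a : Fin h → ℕ) {b : Fin h → ℕ} (hb : ∑ i, b i = n) :
    ext (dpMonomial h n a) (mon b) = if b = a then 1 else 0 := by
  classical
  rw [ext_apply _ (mon_mem hb)]
  change coeff (Finsupp.equivFunOnFinite.symm a) (mon b) = _
  rw [mon, coeff_monomial]
  simp

theorem steenrodSq_mon {h : ℕ} (k : ℕ) (a : Fin h → ℕ) :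
    steenrodSq h k (mon a) = ∑ j ∈ Fintype.piFinset fun i => Finset.range (a i + 1),
      if ∑ i, j i = k then ((∏ i, (a i).choose (j i) : ℕ) : ZMod 2) • mon (a + j) else 0 := by
  have h1 : totalSq h (mon a) = ∑ j ∈ Fintype.piFinset fun i => Finset.range (a i + 1),
      Polynomial.C (((∏ i, (a i).choose (j i) : ℕ) : ZMod 2) • mon (a + j)) *
        Polynomial.X ^ (∑ i, j i) := by
    have hX : ∀ i, totalSq h (X i) ^ a i = ∑ m ∈ Finset.range (a i + 1),
        Polynomial.C (((a i).choose m : Poly h) * X i ^ (a i + m)) * Polynomial.X ^ m := by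
      intro i
      simp only [totalSq, aeval_X]
      rw [add_comm, add_pow]
      refine Finset.sum_congr rfl fun m hm => ?_
      have hm : m ≤ a i := Nat.lt_succ_iff.1 (Finset.mem_range.1 hm)
      rw [mul_pow, ← Polynomial.C_pow, ← Polynomial.C_pow, ← Polynomial.C_eq_natCast,
        mul_assoc, mul_right_comm, ← mul_assoc, ← Polynomial.C_mul, ← Polynomial.C_mul, ← pow_mul,
        show a i + m = 2 * m + (a i - m) by omega, pow_add, mul_left_comm, mul_assoc,
        mul_comm (X i ^ (a i - m))]
    rw [mon_eq_prod, map_prod]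
    simp only [map_pow, hX]
    rw [Finset.prod_univ_sum]
    refine Finset.sum_congr rfl fun j _ => ?_
    rw [Finset.prod_mul_distrib, Finset.prod_pow_eq_pow_sum, ← map_prod, Finset.prod_mul_distrib,
      mon_eq_prod, Nat.cast_prod, Algebra.smul_def, map_prod]
    simp
  change (totalSq h (mon a)).coeff k = _
  rw [h1, Polynomial.finsetSum_coeff]
  refine Finset.sum_congr rfl fun j _ => ?_
  rw [Polynomial.coeff_C_mul, Polynomial.coeff_X_pow]
  simp only [eq_comm (a := k), mul_ite, mul_one, mul_zero]

theorem ext_steenrodSq_mon {h n : ℕ} (φ : HomologyDeg h n) (k : ℕ) (a : Fin h → ℕ) :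
    ext φ (steenrodSq h k (mon a)) = ∑ j ∈ Fintype.piFinset fun i => Finset.range (a i + 1),
      if ∑ i, j i = k then
        ((∏ i, (a i).choose (j i) : ℕ) : ZMod 2) * ext φ (mon (a + j)) else 0 := by
  rw [steenrodSq_mon, map_sum]
  refine Finset.sum_congr rfl fun j _ => ?_
  split_ifs
  · rw [map_smul, smul_eq_mul]
  · rw [map_zero]

theorem mem_annihilated_iff {h n : ℕ} {φ : HomologyDeg h n} :
    φ ∈ annihilated h n ↔ ∀ (a : Fin h → ℕ) (k : ℕ), 0 < k → ∑ i, a i + k = n →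
      ext φ (steenrodSq h k (mon a)) = 0 := by
  constructor
  · intro H a k hk e
    have h1 := DFunLike.congr_fun (H _ k e hk) ⟨mon a, mon_mem rfl⟩
    rw [ext_apply φ (by subst e; exact steenrodSq_isHomogeneous k (mon_mem rfl))]
    exact h1
  · intro H m k e hk
    refine eq_zero_of_ext fun a ha => ?_
    rw [ext_apply _ (mon_mem ha)]
    have h1 := H a k hk (by rw [ha, e])
    rw [ext_apply φ (by subst e; exact steenrodSq_isHomogeneous k (mon_mem ha))] at h1
    exact h1

theorem ext_homologyRep {h n : ℕ} (g : Matrix.GeneralLinearGroup (Fin h) (ZMod 2))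
    (φ : HomologyDeg h n) {f : Poly h} (hf : f ∈ PolyDeg h n) :
    ext (homologyRep h n g φ) f = ext φ (subst h g.1 f) := by
  rw [ext_apply _ hf, ext_apply _ (subst_isHomogeneous g.1 hf)]
  rfl

theorem homologyRep_mem_annihilated {h n : ℕ} (g : Matrix.GeneralLinearGroup (Fin h) (ZMod 2))
    {φ : HomologyDeg h n} (hφ : φ ∈ annihilated h n) : homologyRep h n g φ ∈ annihilated h n :=
  annihilated_le_comap h n g hφ

/-! ### Steenrod squares of monomials modulo 2 -/

/-- The case `p = 2` of Lucas' theorem: `n.choose k` is odd if and only if the binary digits of `k`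
are among those of `n`. -/
theorem natCast_choose_zmod_two (n k : ℕ) :
    ((n.choose k : ℕ) : ZMod 2) = if n &&& k = k then 1 else 0 := by
  induction n using Nat.strong_induction_on generalizing k with
  | _ n ih =>
    rcases Nat.eq_zero_or_pos n with rfl | hn
    · rcases Nat.eq_zero_or_pos k with rfl | hk
      · simp
      · rw [Nat.choose_eq_zero_of_lt hk, if_neg (by rw [Nat.zero_and]; omega)]
        rfl
    · have h1 := (ZMod.natCast_eq_natCast_iff _ _ 2).2
        (Choose.choose_modEq_choose_mod_mul_choose_div_nat (n := n) (k := k) (p := 2))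
      rw [h1, Nat.cast_mul, ih (n / 2) (by omega)]
      have h2 : n &&& k = k ↔ (n % 2 &&& k % 2 = k % 2) ∧ (n / 2 &&& k / 2 = k / 2) := by
        have h3 := Nat.and_mod_two_pow (a := n) (b := k) (n := 1)
        rw [pow_one] at h3
        rw [← Nat.and_div_two, ← h3]
        omega
      rcases Nat.mod_two_eq_zero_or_one n with e1 | e1 <;>
        rcases Nat.mod_two_eq_zero_or_one k with e2 | e2 <;> simp [h2, e1, e2]

theorem natCast_prod_choose {h : ℕ} (a j : Fin h → ℕ) :
    ((∏ i, (a i).choose (j i) : ℕ) : ZMod 2) = if ∀ i, a i &&& j i = j i then 1 else 0 := by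
  rw [Nat.cast_prod]
  simp only [natCast_choose_zmod_two]
  rw [Finset.prod_boole]
  simp

theorem ext_steenrodSq {h n : ℕ} (φ : HomologyDeg h n) (k : ℕ) (a : Fin h → ℕ) :
    ext φ (steenrodSq h k (mon a)) = ∑ j ∈ Finset.Nat.antidiagonalTuple h k,
      if ∀ i, a i &&& j i = j i then ext φ (mon (a + j)) else 0 := by
  rw [ext_steenrodSq_mon, ← Finset.sum_filter]
  simp only [natCast_prod_choose, ite_mul, one_mul, zero_mul]
  refine Finset.sum_subset (fun j hj => ?_) fun j hj hj' => if_neg fun H => hj' ?_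
  · exact Finset.Nat.mem_antidiagonalTuple.2 (Finset.mem_filter.1 hj).2
  · refine Finset.mem_filter.2 ⟨Fintype.mem_piFinset.2 fun i => Finset.mem_range.2 ?_,
      Finset.Nat.mem_antidiagonalTuple.1 hj⟩
    have := Nat.and_le_left (n := a i) (m := j i)
    rw [H i] at this
    omega

/-! ### Sums of divided power monomials -/

theorem ext_sum_dpMonomial {h n : ℕ} (L : List (Fin h → ℕ)) {b : Fin h → ℕ}
    (hb : ∑ i, b i = n) :
    ext (L.map (dpMonomial h n)).sum (mon b) = ((L.count b : ℕ) : ZMod 2) := by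
  induction L with
  | nil => rfl
  | cons m L ih =>
    rw [List.map_cons, List.sum_cons, ext_add, ih, ext_dpMonomial _ hb, List.count_cons, add_comm]
    by_cases e : b = m
    · simp [e]
    · simp [e, Ne.symm e]

/-- `t^m` is a term of the total square of `t^a`. -/
def Covers {h : ℕ} (a m : Fin h → ℕ) : Prop :=
  ∀ i, a i ≤ m i ∧ a i &&& (m i - a i) = m i - a i

instance {h : ℕ} (a m : Fin h → ℕ) : Decidable (Covers a m) :=
  inferInstanceAs (Decidable (∀ _, _))

theorem ext_steenrodSq_sum_dpMonomial {h n : ℕ} {L : List (Fin h → ℕ)}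
    (hL : ∀ m ∈ L, ∑ i, m i = n) {k : ℕ} {a : Fin h → ℕ} (ha : ∑ i, a i + k = n) :
    ext (L.map (dpMonomial h n)).sum (steenrodSq h k (mon a))
      = ((L.countP fun m => Covers a m : ℕ) : ZMod 2) := by
  rw [ext_steenrodSq]
  have h1 : ∀ j ∈ Finset.Nat.antidiagonalTuple h k,
      (if ∀ i, a i &&& j i = j i then ext (L.map (dpMonomial h n)).sum (mon (a + j)) else 0)
        = (((if ∀ i, a i &&& j i = j i then L.count (a + j) else 0 : ℕ)) : ZMod 2) := by
    intro j hj
    split_ifs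
    · refine ext_sum_dpMonomial L ?_
      rw [← ha, ← Finset.Nat.mem_antidiagonalTuple.1 hj, ← Finset.sum_add_distrib]
      rfl
    · rw [Nat.cast_zero]
  rw [Finset.sum_congr rfl h1, ← Nat.cast_sum]
  congr 1
  clear h1
  induction L with
  | nil => simp
  | cons m L ih =>
    rw [List.countP_cons, ← ih fun m hm => hL m (List.mem_cons_of_mem _ hm)]
    simp only [List.count_cons]
    have h2 : ∀ j : Fin h → ℕ, (if ∀ i, a i &&& j i = j i then
        L.count (a + j) + (if (m == a + j) = true then 1 else 0) else 0)
        = (if ∀ i, a i &&& j i = j i then L.count (a + j) else 0)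
          + if (∀ i, a i &&& j i = j i) ∧ m = a + j then 1 else 0 := by
      intro j
      by_cases h3 : ∀ i, a i &&& j i = j i <;> simp [h3]
    simp only [h2]
    rw [Finset.sum_add_distrib]
    congr 1
    by_cases hc : Covers a m
    · have hm : m = a + (m - a) := by
        ext i
        have := (hc i).1
        simp only [Pi.add_apply, Pi.sub_apply]
        omega
      rw [Finset.sum_eq_single (m - a)]
      · rw [if_pos ⟨fun i => (hc i).2, hm⟩, if_pos (by simpa using hc)]
      · rintro j - hj
        refine if_neg fun h3 => hj ?_
        rw [h3.2]
        simp
      · intro h3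
        refine absurd (Finset.Nat.mem_antidiagonalTuple.2 ?_) h3
        have h4 := hL m List.mem_cons_self
        rw [hm] at h4
        simp only [Pi.add_apply, Finset.sum_add_distrib] at h4
        omega
    · rw [if_neg (by simpa using hc)]
      refine Finset.sum_eq_zero fun j _ => if_neg ?_
      rintro ⟨h3, rfl⟩
      refine hc fun i => ⟨Nat.le_add_right _ _, ?_⟩
      simpa using h3 i

/-- The values `x` for which `t^m` is a term of the total square of `t^x` (one variable). -/
def preimages (m : ℕ) : List ℕ :=
  (List.range (m + 1)).filter fun x => Nat.beq (x &&& (m - x)) (m - x)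

theorem mem_preimages {x m : ℕ} : x ∈ preimages m ↔ x ≤ m ∧ x &&& (m - x) = m - x := by
  simp [preimages]

/-- A test for `Ā`-annihilation of the sum of the divided power monomials with exponents `L`: every
monomial of smaller degree has an even number of the terms of `L` in its total square. -/
def annihilatedTest (n : ℕ) (L : List (Fin 4 → ℕ)) : Bool :=
  L.all fun m => Nat.beq (m 0 + m 1 + m 2 + m 3) n &&
    (preimages (m 0)).all fun x => (preimages (m 1)).all fun y =>
    (preimages (m 2)).all fun z => (preimages (m 3)).all fun w =>
      Nat.beq (x + y + z + w) n || Nat.beq ((L.countP fun m => Covers ![x, y, z, w] m) % 2) 0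

theorem sum_dpMonomial_mem_annihilated {n : ℕ} {L : List (Fin 4 → ℕ)}
    (hL : annihilatedTest n L = true) : (L.map (dpMonomial 4 n)).sum ∈ annihilated 4 n := by
  simp only [annihilatedTest, List.all_eq_true, Bool.and_eq_true, Nat.beq_eq,
    Bool.or_eq_true, mem_preimages] at hL
  rw [mem_annihilated_iff]
  intro a k hk ha
  rw [ext_steenrodSq_sum_dpMonomial (fun m hm => by rw [Fin.sum_univ_four, (hL m hm).1]) ha]
  by_cases h0 : ∃ m ∈ L, Covers a m
  · obtain ⟨m, hm, hc⟩ := h0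
    have h1 := (hL m hm).2 _ (hc 0) _ (hc 1) _ (hc 2) _ (hc 3)
    rw [Fin.sum_univ_four] at ha
    have h2 : ![a 0, a 1, a 2, a 3] = a := by
      ext i
      fin_cases i <;> rfl
    rw [h2] at h1
    have h3 := h1.resolve_left (by omega)
    exact (ZMod.natCast_eq_zero_iff _ _).2 (Nat.dvd_of_mod_eq_zero h3)
  · push Not at h0
    rw [List.countP_eq_zero.2 fun m hm => by simpa using h0 m hm, Nat.cast_zero]

theorem annihilatedTest_zetaExponents : annihilatedTest 38 zetaExponents = true := by
  decide +kernel

theorem annihilatedTest_spike : annihilatedTest 38 [![0, 0, 7, 31]] = true := by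
  decide +kernel

theorem zetaTilde_mem : zetaTilde ∈ annihilated 4 38 := by
  have h1 := sum_dpMonomial_mem_annihilated annihilatedTest_zetaExponents
  unfold zetaTilde
  -- The list is generalized so that comparing the types does not evaluate it.
  generalize zetaExponents = L at h1 ⊢
  exact h1

theorem spike_mem : dpMonomial 4 38 ![0, 0, 7, 31] ∈ annihilated 4 38 := by
  simpa using sum_dpMonomial_mem_annihilated annihilatedTest_spike

/-! ### Sets of monomials of degree 38 as bit masks -/

/-- The position of the monomial `t^a` in a bit mask. On the monomials of degree 38 it determines
`a`, and it is additive in `a`. -/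
def code (a : Fin 4 → ℕ) : ℕ := a 0 + 39 * a 1 + 1521 * a 2

theorem code_injective {a b : Fin 4 → ℕ} (ha : ∑ i, a i = 38) (hb : ∑ i, b i = 38)
    (h : code a = code b) : a = b := by
  rw [Fin.sum_univ_four] at ha hb
  unfold code at h
  have h0 : a 0 = b 0 := by omega
  have h1 : a 1 = b 1 := by omega
  have h2 : a 2 = b 2 := by omega
  have h3 : a 3 = b 3 := by omega
  ext i
  fin_cases i <;> assumption

/-- The concatenation of `f 0, …, f (n - 1)` as blocks of `w` bits. -/
def stack (w : ℕ) (f : ℕ → ℕ) : ℕ → ℕ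
  | 0 => 0
  | n + 1 => stack w f n ||| (f n <<< (w * n))

theorem stack_lt {w : ℕ} {f : ℕ → ℕ} (hf : ∀ v, f v < 2 ^ w) (n : ℕ) :
    stack w f n < 2 ^ (w * n) := by
  induction n with
  | zero => simp [stack]
  | succ n ih =>
    refine Nat.or_lt_two_pow (ih.trans_le (Nat.pow_le_pow_right two_pos (by gcongr; omega))) ?_
    rw [Nat.shiftLeft_eq, mul_add, mul_one, pow_add, mul_comm]
    exact Nat.mul_lt_mul_of_pos_left (hf n) (by positivity)

theorem testBit_stack {w : ℕ} {f : ℕ → ℕ} (hf : ∀ v, f v < 2 ^ w) {p : ℕ} (hp : p < w) (n v : ℕ) :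
    (stack w f n).testBit (w * v + p) = (decide (v < n) && (f v).testBit p) := by
  induction n with
  | zero => simp [stack]
  | succ n ih =>
    rw [stack, Nat.testBit_or, ih, Nat.testBit_shiftLeft]
    rcases lt_trichotomy v n with h | rfl | h
    · have h1 : ¬ w * n ≤ w * v + p := by
        have : w * (v + 1) ≤ w * n := Nat.mul_le_mul_left w h
        rw [mul_add] at this
        omega
      simp [h, h1, h.trans (Nat.lt_succ_self n)]
    · simp
    · have h1 : w ≤ w * v + p - w * n := by
        have : w * (n + 1) ≤ w * v := Nat.mul_le_mul_left w h
        rw [mul_add] at this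
        omega
      rw [Nat.testBit_lt_two_pow ((hf n).trans_le (Nat.pow_le_pow_right two_pos h1))]
      have h2 : ¬ v < n := by omega
      have h3 : ¬ v < n + 1 := by omega
      simp [h2, h3]

/-- The set of the `v ≤ 38` such that `P v`. -/
def row (P : ℕ → Bool) : ℕ := stack 1 (fun v => (P v).toNat) 39

theorem row_lt (P : ℕ → Bool) : row P < 2 ^ 39 :=
  stack_lt (fun v => by cases P v <;> decide) 39

theorem testBit_row (P : ℕ → Bool) (v : ℕ) : (row P).testBit v = (decide (v < 39) && P v) := by
  have h1 := testBit_stack (w := 1) (f := fun v => (P v).toNat)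
    (fun v => by cases P v <;> decide) one_pos 39 v
  rw [one_mul, add_zero] at h1
  rw [row, h1]
  cases P v <;> rfl

/-- A mask that selects, among the monomials of degree 38, those whose exponent of `t_i`
satisfies `P`. For `i = 3` it contains no other positions; the exponent of `t_3` is not visible in
the position and is recovered from the degree. -/
def mask (i : Fin 4) (P : ℕ → Bool) : ℕ :=
  match i with
  | 0 => stack 1521 (fun _ => stack 39 (fun _ => row P) 39) 39
  | 1 => stack 1521 (fun _ => stack 39 (fun v => bif P v then row fun _ => true else 0) 39) 39
  | 2 => stack 1521 (fun v => bif P v then stack 39 (fun _ => row fun _ => true) 39 else 0) 39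
  | 3 => stack 1521 (fun u => stack 39 (fun v => row (fun n => P (38 - n)) >>> (v + u)) 39) 39

theorem testBit_mask (i : Fin 4) (P : ℕ → Bool) {a : Fin 4 → ℕ} (ha : ∑ i, a i = 38) :
    (mask i P).testBit (code a) = P (a i) := by
  rw [Fin.sum_univ_four] at ha
  have hc : code a = 1521 * a 2 + (39 * a 1 + a 0) := by
    unfold code
    omega
  have h0 : a 0 < 39 := by omega
  have h1 : a 1 < 39 := by omega
  have h2 : a 2 < 39 := by omega
  have h10 : 39 * a 1 + a 0 < 1521 := by omega
  have hlt : ∀ {f : ℕ → ℕ}, (∀ v, f v < 2 ^ 39) → stack 39 f 39 < 2 ^ 1521 :=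
    fun hf => (show 39 * 39 = 1521 from rfl) ▸ stack_lt hf 39
  have hb : ∀ (b : Bool) {w m : ℕ}, m < 2 ^ w → (bif b then m else 0) < 2 ^ w := by
    intro b w m hm
    cases b
    · exact Nat.two_pow_pos w
    · exact hm
  have hs : ∀ (Q : ℕ → Bool) (s : ℕ), row Q >>> s < 2 ^ 39 :=
    fun Q s => (Nat.shiftRight_le _ _).trans_lt (row_lt Q)
  rw [hc]
  fin_cases i
  · change (stack 1521 (fun _ => stack 39 (fun _ => row P) 39) 39).testBit _ = P (a 0)
    rw [testBit_stack (fun _ => hlt fun _ => row_lt P) h10, testBit_stack (fun _ => row_lt P) h0,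
      testBit_row]
    simp [h0, h1, h2]
  · change (stack 1521 (fun _ => stack 39 (fun v => bif P v then row fun _ => true else 0) 39)
      39).testBit _ = P (a 1)
    rw [testBit_stack (fun _ => hlt fun v => hb _ (row_lt _)) h10,
      testBit_stack (fun v => hb _ (row_lt _)) h0]
    cases P (a 1) <;> simp [testBit_row, h0, h1, h2]
  · change (stack 1521 (fun v => bif P v then stack 39 (fun _ => row fun _ => true) 39 else 0)
      39).testBit _ = P (a 2)
    rw [testBit_stack (fun v => hb _ (hlt fun _ => row_lt _)) h10]
    cases P (a 2)
    · simp
    · rw [cond_true, testBit_stack (fun _ => row_lt _) h0]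
      simp [testBit_row, h0, h1, h2]
  · change (stack 1521 (fun u => stack 39 (fun v => row (fun n => P (38 - n)) >>> (v + u)) 39)
      39).testBit _ = P (a 3)
    rw [testBit_stack (fun u => hlt fun v => hs _ _) h10, testBit_stack (fun v => hs _ _) h0,
      Nat.testBit_shiftRight, testBit_row, show 38 - (a 1 + a 2 + a 0) = a 3 by omega]
    have h4 : a 1 + a 2 + a 0 < 39 := by omega
    simp [h1, h2, h4]

/-- The set of all monomials of degree 38. -/
def full : ℕ := mask 3 fun _ => true

/-- The set of the monomials that occur an odd number of times in a list. -/
def maskOf (L : List (Fin 4 → ℕ)) : ℕ := L.foldr (fun a m => 1 <<< code a ^^^ m) 0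

theorem testBit_one_shiftLeft (c d : ℕ) : (1 <<< c).testBit d = decide (c = d) := by
  rw [Nat.one_shiftLeft, Nat.testBit_two_pow]

theorem testBit_maskOf {L : List (Fin 4 → ℕ)} (hL : ∀ m ∈ L, ∑ i, m i = 38) {a : Fin 4 → ℕ}
    (ha : ∑ i, a i = 38) :
    (if (maskOf L).testBit (code a) then 1 else 0 : ZMod 2) = ((L.count a : ℕ) : ZMod 2) := by
  induction L with
  | nil => simp [maskOf]
  | cons m L ih =>
    rw [List.count_cons, Nat.cast_add, ← ih fun m hm => hL m (List.mem_cons_of_mem _ hm)]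
    change (if (1 <<< code m ^^^ maskOf L).testBit (code a) then 1 else 0 : ZMod 2) = _
    rw [Nat.testBit_xor, testBit_one_shiftLeft]
    have h1 : code m = code a ↔ m = a :=
      ⟨fun h => code_injective (hL m List.mem_cons_self) ha h, fun h => h ▸ rfl⟩
    by_cases h2 : m = a <;> cases (maskOf L).testBit (code a) <;> simp [h1, h2]
    rfl

/-- The bit mask `N` lists the values of a homology class on the monomials. -/
def Represents (N : ℕ) (φ : HomologyDeg 4 38) : Prop :=
  ∀ a : Fin 4 → ℕ, ∑ i, a i = 38 → ext φ (mon a) = if N.testBit (code a) then 1 else 0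

theorem represents_maskOf {L : List (Fin 4 → ℕ)} (hL : ∀ m ∈ L, ∑ i, m i = 38) :
    Represents (maskOf L) (L.map (dpMonomial 4 38)).sum := fun a ha => by
  rw [ext_sum_dpMonomial L ha, testBit_maskOf hL ha]

/-! ### Peeling -/

/-- Evaluation of `f` at `n`. In kernel reduction the recursion on `n` replaces an unevaluated
argument by its value before `f` is unfolded. -/
def force {α : Type} (n : ℕ) (f : ℕ → α) : α := Nat.rec (f 0) (fun k _ => f (k + 1)) n

@[simp] theorem force_eq {α : Type} (n : ℕ) (f : ℕ → α) : force n f = f n := by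
  cases n <;> rfl

/-- The monomials of degree 38 that occur, in the variable `t_i`, as a term of `Sq^k` with all
squares taken on `t_i`: those whose exponent `v` satisfies that `(v - k).choose k` is odd. -/
def oddMask (i : Fin 4) (k : ℕ) : ℕ := mask i fun v => Nat.ble k v && Nat.beq ((v - k) &&& k) k

theorem testBit_oddMask (i : Fin 4) (k : ℕ) {a : Fin 4 → ℕ} (ha : ∑ i, a i = 38) :
    (oddMask i k).testBit (code a) = true ↔ k ≤ a i ∧ (a i - k) &&& k = k := by
  rw [oddMask, testBit_mask i _ ha, Bool.and_eq_true, Nat.ble_eq, Nat.beq_eq]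

/-- The table of the `oddMask i k` for `k ≤ 8`. -/
def oddMaskTable (i : Fin 4) : List ℕ := (List.range 9).map (oddMask i)

theorem oddMaskTable_getD (i : Fin 4) {k : ℕ} (hk : k ≤ 8) :
    (oddMaskTable i).getD k 0 = oddMask i k := by
  rw [oddMaskTable, List.getD_eq_getElem?_getD, List.getElem?_map,
    List.getElem?_range (Nat.lt_succ_of_le hk)]
  rfl

/-- The monomials `t^m` of degree 38 such that `t^(m - j)` has `t^m` as a term of its total
square. -/
def termMask (j : Fin 4 → ℕ) : ℕ :=
  ((oddMaskTable 0).getD (j 0) 0 &&& (oddMaskTable 1).getD (j 1) 0) &&&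
    ((oddMaskTable 2).getD (j 2) 0 &&& (oddMaskTable 3).getD (j 3) 0)

theorem testBit_termMask {j : Fin 4 → ℕ} {k : ℕ} (hk : k ≤ 8) (hj : ∑ i, j i = k)
    {a : Fin 4 → ℕ} (ha : ∑ i, a i = 38) :
    (termMask j).testBit (code a) = true ↔ ∀ i, j i ≤ a i ∧ (a i - j i) &&& j i = j i := by
  rw [Fin.sum_univ_four] at hj
  rw [termMask, oddMaskTable_getD _ (by omega), oddMaskTable_getD _ (by omega),
    oddMaskTable_getD _ (by omega), oddMaskTable_getD _ (by omega)]
  simp only [Nat.testBit_and, Bool.and_eq_true, testBit_oddMask _ _ ha]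
  refine ⟨fun h i => ?_, fun h => ⟨⟨h 0, h 1⟩, h 2, h 3⟩⟩
  fin_cases i
  exacts [h.1.1, h.1.2, h.2.1, h.2.2]

/-- The terms `t^b ↦ t^(b + j)` of `Sq^k`, each as the shift of positions that it causes together
with the mask of the monomials `t^(b + j)` for which it is present. -/
def terms (k : ℕ) : List (ℕ × ℕ) :=
  (List.Nat.antidiagonalTuple 4 k).map fun j => (code j, termMask j)

/-- The positions of the `t^b` whose image under a term of `Sq^k` is in `U`. -/
def present (U : ℕ) (t : ℕ × ℕ) : ℕ := (U &&& t.2) >>> t.1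

/-- The positions covered at least once, and at least twice, by the sets `present U t`. -/
def tally (U : ℕ) : List (ℕ × ℕ) → ℕ × ℕ
  | [] => (0, 0)
  | t :: T => force (present U t) fun p =>
      match tally U T with
      | (o, w) => (o ||| p, w ||| (o &&& p))

theorem testBit_tally (U c : ℕ) (T : List (ℕ × ℕ)) :
    (tally U T).1.testBit c = decide (1 ≤ T.countP fun t => (present U t).testBit c) ∧
      (tally U T).2.testBit c = decide (2 ≤ T.countP fun t => (present U t).testBit c) := by
  induction T with
  | nil => simp [tally]
  | cons t T ih =>
    rw [tally, force_eq, List.countP_cons]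
    simp only [Nat.testBit_or, Nat.testBit_and, ih.1, ih.2]
    generalize T.countP _ = n
    cases (present U t).testBit c
    · simp
    · simp
      omega

/-- The images in `U` of the `t^b` at the positions `E`, under the terms `T`. -/
def images (U E : ℕ) : List (ℕ × ℕ) → ℕ
  | [] => 0
  | t :: T => ((present U t &&& E) <<< t.1) ||| images U E T

theorem testBit_images {U E c : ℕ} {T : List (ℕ × ℕ)} (h : (images U E T).testBit c = true) :
    ∃ t ∈ T, t.1 ≤ c ∧ (present U t).testBit (c - t.1) = true ∧ E.testBit (c - t.1) = true := by
  induction T with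
  | nil => simp [images] at h
  | cons t T ih =>
    rw [images, Nat.testBit_or, Bool.or_eq_true, Nat.testBit_shiftLeft, Bool.and_eq_true,
      Nat.testBit_and, Bool.and_eq_true, decide_eq_true_eq] at h
    rcases h with h | h
    · exact ⟨t, List.mem_cons_self, h⟩
    · obtain ⟨t', ht', h'⟩ := ih h
      exact ⟨t', List.mem_cons_of_mem _ ht', h'⟩

/-- Removes from `U` each monomial that is the only term in `U` of some `Sq^k (t^b)`. -/
def peelPass (U : ℕ) (T : List (ℕ × ℕ)) : ℕ :=
  match tally U T with
  | (o, w) => force (o ^^^ (o &&& w)) fun E => U ^^^ (U &&& images U E T)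

theorem peelPass_eq (U : ℕ) (T : List (ℕ × ℕ)) : peelPass U T = U ^^^ (U &&&
    images U ((tally U T).1 ^^^ ((tally U T).1 &&& (tally U T).2)) T) := by
  unfold peelPass
  rcases tally U T with ⟨o, w⟩
  exact force_eq _ _

/-- `φ` vanishes on the monomials of degree 38 outside of `U`. -/
def VanishesOff (U : ℕ) (φ : HomologyDeg 4 38) : Prop :=
  ∀ a : Fin 4 → ℕ, ∑ i, a i = 38 → U.testBit (code a) = false → ext φ (mon a) = 0

theorem VanishesOff.peelPass {U : ℕ} {φ : HomologyDeg 4 38} (hφ : φ ∈ annihilated 4 38)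
    (hU : VanishesOff U φ) {k : ℕ} (hk : k ≤ 8) (hk0 : 0 < k) :
    VanishesOff (peelPass U (terms k)) φ := by
  intro a ha h
  by_cases hUa : U.testBit (code a) = true
  swap
  · exact hU a ha (by simpa using hUa)
  rw [peelPass_eq, Nat.testBit_xor, Nat.testBit_and, hUa] at h
  obtain ⟨t, ht, h1, h2, h3⟩ := testBit_images (U := U) (by simpa using h)
  obtain ⟨j, hj, rfl⟩ := List.mem_map.1 ht
  have hjk := List.Nat.mem_antidiagonalTuple.1 hj
  simp only at h1 h2 h3
  have h4 := h2
  rw [present, Nat.testBit_shiftRight, Nat.testBit_and, show code j + (code a - code j) = code a by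
    omega, Bool.and_eq_true] at h4
  have h5 := (testBit_termMask hk hjk ha).1 h4.2
  -- `t^a` is a term of `Sq^k (t^b)` for `b = a - j`.
  obtain ⟨b, rfl⟩ : ∃ b, a = b + j := ⟨a - j, by
    ext i
    have := (h5 i).1
    simp only [Pi.add_apply, Pi.sub_apply]
    omega⟩
  have hadd : ∀ j, code (b + j) = code j + code b := fun j => by
    simp only [code, Pi.add_apply]
    ring
  have hb : ∑ i, b i + k = 38 := by
    rw [← ha, ← hjk, ← Finset.sum_add_distrib]
    rfl
  rw [hadd, Nat.add_sub_cancel_left] at h2 h3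
  have h6 := mem_annihilated_iff.1 hφ b k hk0 hb
  rw [ext_steenrodSq] at h6
  -- The other terms vanish: exactly one of the terms is in `U`.
  rw [Finset.sum_eq_single j, if_pos fun i => by simpa using (h5 i).2] at h6
  · exact h6
  · intro j' hj' hne
    have hj'k := Finset.Nat.mem_antidiagonalTuple.1 hj'
    refine ite_eq_right_iff.2 fun h7 => ?_
    have hb' : ∑ i, (b + j') i = 38 := by
      rw [← hb, ← hj'k, ← Finset.sum_add_distrib]
      rfl
    refine hU _ hb' ?_
    by_contra h8
    have h9 : (present U (code j', termMask j')).testBit (code b) = true := by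
      rw [present, Nat.testBit_shiftRight, Nat.testBit_and, ← hadd, Bool.and_eq_true]
      refine ⟨by simpa using h8, (testBit_termMask hk hj'k hb').2 fun i => ?_⟩
      simpa using h7 i
    rw [Nat.testBit_xor, Nat.testBit_and, (testBit_tally _ _ _).1, (testBit_tally _ _ _).2,
      terms, List.countP_map, List.countP_eq_length_filter] at h3
    set F := (List.Nat.antidiagonalTuple 4 k).filter
      ((fun t => (present U t).testBit (code b)) ∘ fun j => (code j, termMask j)) with hF
    have hm : ∀ {i}, i ∈ List.Nat.antidiagonalTuple 4 k →
        (present U (code i, termMask i)).testBit (code b) = true → i ∈ F :=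
      fun hi hi' => List.mem_filter.2 ⟨hi, hi'⟩
    have hlen : F.length = 1 := by
      by_contra hne1
      revert h3
      rcases Nat.lt_or_gt_of_ne hne1 with hl | hl
      · have : ¬ 1 ≤ F.length := by omega
        simp [this]
      · have h10 : 1 ≤ F.length := by omega
        have h11 : 2 ≤ F.length := hl
        simp [h10, h11]
    obtain ⟨x, hx⟩ := List.length_eq_one_iff.1 hlen
    have e1 := hm hj h2
    have e2 := hm (List.Nat.mem_antidiagonalTuple.2 hj'k) h9
    rw [hx, List.mem_singleton] at e1 e2
    exact hne (e2.trans e1.symm)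
  · exact fun h7 => absurd (Finset.Nat.mem_antidiagonalTuple.2 hjk) h7

/-- Whether `n` rounds of removals with `Sq^1`, `Sq^2`, `Sq^4` and `Sq^8` exhaust `U`. -/
def peel : ℕ → ℕ → Bool
  | 0, U => Nat.beq U 0
  | n + 1, U => force (peelPass U (terms 1)) fun U => force (peelPass U (terms 2)) fun U =>
      force (peelPass U (terms 4)) fun U => force (peelPass U (terms 8)) fun U => peel n U

theorem eq_zero_of_peel {φ : HomologyDeg 4 38} (hφ : φ ∈ annihilated 4 38) {n U : ℕ}
    (hU : VanishesOff U φ) (h : peel n U = true) : φ = 0 := by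
  induction n generalizing U with
  | zero =>
    rw [peel, Nat.beq_eq] at h
    subst h
    exact eq_zero_of_ext fun a ha => hU a ha (Nat.zero_testBit _)
  | succ n ih =>
    simp only [peel, force_eq] at h
    exact ih ((((hU.peelPass hφ (by decide) one_pos).peelPass hφ (by decide) two_pos).peelPass hφ
      (by decide) (by decide)).peelPass hφ (by decide) (by decide)) h

/-! ### Monomials that determine an annihilated class -/

/-- The exponents of the 101 monomials in an invariant polynomial: modulo the images of the Steenrod
squares of positive degree, the sum of these monomials is fixed by `GL_4`. Its value is `1` on the
orbit of `x_1^{(0)} x_2^{(0)} x_3^{(7)} x_4^{(31)}` and `0` on the orbit of `ζ̃`. -/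
def spikeDualExponents : List (Fin 4 → ℕ) :=
  [![7, 31, 0, 0], ![15, 23, 0, 0], ![31, 7, 0, 0], ![7, 0, 31, 0], ![15, 0, 23, 0],
    ![31, 0, 7, 0], ![7, 0, 0, 31], ![15, 0, 0, 23], ![31, 0, 0, 7], ![0, 7, 31, 0],
    ![0, 15, 23, 0], ![0, 31, 7, 0], ![0, 7, 0, 31], ![0, 15, 0, 23], ![0, 31, 0, 7],
    ![0, 0, 7, 31], ![0, 0, 15, 23], ![0, 0, 31, 7], ![1, 6, 31, 0], ![1, 7, 30, 0],
    ![1, 14, 23, 0], ![1, 15, 22, 0], ![1, 30, 7, 0], ![1, 31, 6, 0], ![3, 5, 30, 0],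
    ![3, 13, 22, 0], ![3, 29, 6, 0], ![7, 1, 30, 0], ![15, 1, 22, 0], ![31, 1, 6, 0],
    ![1, 6, 0, 31], ![1, 7, 0, 30], ![1, 14, 0, 23], ![1, 15, 0, 22], ![1, 30, 0, 7],
    ![1, 31, 0, 6], ![3, 5, 0, 30], ![3, 13, 0, 22], ![3, 29, 0, 6], ![7, 1, 0, 30],
    ![15, 1, 0, 22], ![31, 1, 0, 6], ![1, 0, 6, 31], ![1, 0, 7, 30], ![1, 0, 14, 23],
    ![1, 0, 15, 22], ![1, 0, 30, 7], ![1, 0, 31, 6], ![3, 0, 5, 30], ![3, 0, 13, 22],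
    ![3, 0, 29, 6], ![7, 0, 1, 30], ![15, 0, 1, 22], ![31, 0, 1, 6], ![0, 1, 6, 31],
    ![0, 1, 7, 30], ![0, 1, 14, 23], ![0, 1, 15, 22], ![0, 1, 30, 7], ![0, 1, 31, 6],
    ![0, 3, 5, 30], ![0, 3, 13, 22], ![0, 3, 29, 6], ![0, 7, 1, 30], ![0, 15, 1, 22],
    ![0, 31, 1, 6], ![1, 1, 14, 22], ![1, 1, 30, 6], ![1, 2, 4, 31], ![1, 2, 5, 30],
    ![1, 2, 7, 28], ![1, 2, 12, 23], ![1, 2, 13, 22], ![1, 2, 15, 20], ![1, 2, 28, 7],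
    ![1, 2, 29, 6], ![1, 2, 31, 4], ![1, 3, 4, 30], ![1, 3, 12, 22], ![1, 3, 14, 20],
    ![1, 3, 28, 6], ![1, 3, 30, 4], ![1, 6, 1, 30], ![1, 7, 2, 28], ![1, 14, 1, 22],
    ![1, 15, 2, 20], ![1, 30, 1, 6], ![1, 31, 2, 4], ![3, 1, 4, 30], ![3, 1, 12, 22],
    ![3, 1, 14, 20], ![3, 1, 28, 6], ![3, 1, 30, 4], ![3, 5, 6, 24], ![3, 5, 10, 20],
    ![3, 5, 26, 4], ![3, 13, 2, 20], ![3, 29, 2, 4], ![7, 1, 2, 28], ![15, 1, 2, 20],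
    ![31, 1, 2, 4]]

/-- The exponents of 91 monomials that complement those of `spikeDualExponents`. -/
def otherBasisExponents : List (Fin 4 → ℕ) :=
  [![1, 1, 6, 30], ![1, 3, 6, 28], ![3, 1, 6, 28], ![3, 5, 2, 28], ![1, 3, 3, 31],
    ![1, 3, 7, 27], ![1, 3, 31, 3], ![1, 7, 3, 27], ![1, 7, 11, 19], ![1, 7, 27, 3],
    ![1, 31, 3, 3], ![3, 1, 3, 31], ![3, 1, 7, 27], ![3, 1, 31, 3], ![3, 3, 1, 31],
    ![3, 3, 3, 29], ![3, 3, 5, 27], ![3, 3, 7, 25], ![3, 3, 29, 3], ![3, 3, 31, 1],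
    ![3, 5, 3, 27], ![3, 5, 11, 19], ![3, 5, 27, 3], ![3, 7, 1, 27], ![3, 7, 3, 25],
    ![3, 7, 9, 19], ![3, 7, 11, 17], ![3, 7, 25, 3], ![3, 7, 27, 1], ![3, 29, 3, 3],
    ![3, 31, 1, 3], ![3, 31, 3, 1], ![7, 1, 3, 27], ![7, 1, 11, 19], ![7, 1, 27, 3],
    ![7, 3, 1, 27], ![7, 3, 3, 25], ![7, 3, 9, 19], ![7, 3, 11, 17], ![7, 3, 25, 3],
    ![7, 3, 27, 1], ![7, 11, 1, 19], ![7, 11, 3, 17], ![7, 11, 17, 3], ![7, 11, 19, 1],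
    ![7, 27, 1, 3], ![7, 27, 3, 1], ![31, 1, 3, 3], ![31, 3, 1, 3], ![31, 3, 3, 1],
    ![1, 7, 15, 15], ![1, 15, 7, 15], ![1, 15, 15, 7], ![3, 5, 15, 15], ![3, 7, 13, 15],
    ![3, 7, 15, 13], ![3, 13, 7, 15], ![3, 13, 15, 7], ![3, 15, 5, 15], ![3, 15, 7, 13],
    ![3, 15, 13, 7], ![3, 15, 15, 5], ![7, 1, 15, 15], ![7, 3, 13, 15], ![7, 3, 15, 13],
    ![7, 7, 9, 15], ![7, 7, 11, 13], ![7, 7, 15, 9], ![7, 11, 5, 15], ![7, 11, 7, 13],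
    ![7, 11, 13, 7], ![7, 11, 15, 5], ![7, 15, 1, 15], ![7, 15, 3, 13], ![7, 15, 7, 9],
    ![7, 15, 11, 5], ![7, 15, 15, 1], ![15, 1, 7, 15], ![15, 1, 15, 7], ![15, 3, 5, 15],
    ![15, 3, 7, 13], ![15, 3, 13, 7], ![15, 3, 15, 5], ![15, 7, 1, 15], ![15, 7, 3, 13],
    ![15, 7, 7, 9], ![15, 7, 11, 5], ![15, 7, 15, 1], ![15, 15, 1, 7], ![15, 15, 3, 5],
    ![15, 15, 7, 1]]

/-- The exponents of 192 monomials of degree 38 that represent a basis of the quotient of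
`P^{⊗4}_{38}` by the images of the Steenrod squares of positive degree. An `Ā`-annihilated class is
determined by its values on them (`eq_zero_of_basisExponents`), and these values are arbitrary
(`rankTest_generators`). -/
def basisExponents : List (Fin 4 → ℕ) := otherBasisExponents ++ spikeDualExponents

theorem sum_eq_of_all {L : List (Fin 4 → ℕ)}
    (h : (L.all fun m => Nat.beq (m 0 + m 1 + m 2 + m 3) 38) = true) :
    ∀ m ∈ L, ∑ i, m i = 38 := fun m hm => by
  rw [Fin.sum_univ_four]
  exact Nat.eq_of_beq_eq_true (List.all_eq_true.1 h m hm)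

theorem sum_basisExponents : ∀ m ∈ basisExponents, ∑ i, m i = 38 :=
  sum_eq_of_all (by decide +kernel)

/-- All monomials of degree 38 outside of `basisExponents` are used up in 26 rounds of peeling. -/
theorem peel_basisExponents :
    peel 26 (full ^^^ (full &&& maskOf basisExponents)) = true := by
  decide +kernel

theorem eq_zero_of_basisExponents {φ : HomologyDeg 4 38} (hφ : φ ∈ annihilated 4 38)
    (h : ∀ a ∈ basisExponents, ext φ (mon a) = 0) : φ = 0 := by
  refine eq_zero_of_peel hφ (fun a ha hU => h a ?_) peel_basisExponents
  have h1 : full.testBit (code a) = true := testBit_mask 3 _ ha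
  have h2 := testBit_maskOf sum_basisExponents ha
  rw [Nat.testBit_xor, Nat.testBit_and, h1] at hU
  rw [if_pos (by simpa using hU)] at h2
  by_contra h3
  rw [List.count_eq_zero.2 h3] at h2
  exact one_ne_zero h2

/-! ### Elementary transvections on monomials -/

/-- The elementary transvection that substitutes `t_j + t_i` for `t_j`, where `p = (i, j)`. -/
noncomputable def transvectionGL (p : Fin 4 × Fin 4) (hp : p.1 ≠ p.2) :
    Matrix.GeneralLinearGroup (Fin 4) (ZMod 2) :=
  Matrix.GeneralLinearGroup.mkOfDetNeZero (Matrix.transvection p.2 p.1 1)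
    (by rw [Matrix.det_transvection_of_ne _ _ hp.symm]; exact one_ne_zero)

theorem subst_transvection_X (p : Fin 4 × Fin 4) (hp : p.1 ≠ p.2) (l : Fin 4) :
    subst 4 (transvectionGL p hp).1 (X l) = if l = p.2 then X p.2 + X p.1 else X l := by
  change subst 4 (Matrix.transvection p.2 p.1 1) (X l) = _
  rw [subst, aeval_X, Matrix.transvection]
  simp only [Matrix.add_apply, Matrix.one_apply, Matrix.single_apply, map_add, add_mul,
    Finset.sum_add_distrib]
  split_ifs with h
  · subst h
    simp [apply_ite C]
  · simp [apply_ite C, Ne.symm h]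

theorem mon_update {h : ℕ} (a : Fin h → ℕ) (j : Fin h) :
    (mon a : Poly h) = mon (Function.update a j 0) * X j ^ a j := by
  rw [mon_eq_prod, mon_eq_prod, ← Finset.mul_prod_erase _ _ (Finset.mem_univ j),
    ← Finset.mul_prod_erase _ (fun i => X i ^ Function.update a j 0 i) (Finset.mem_univ j),
    Function.update_self, pow_zero, one_mul, mul_comm]
  congr 1
  refine Finset.prod_congr rfl fun i hi => ?_
  rw [Function.update_of_ne (Finset.ne_of_mem_erase hi)]

theorem subst_transvection_mon (p : Fin 4 × Fin 4) (hp : p.1 ≠ p.2) (a : Fin 4 → ℕ) :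
    subst 4 (transvectionGL p hp).1 (mon a)
      = mon (Function.update a p.2 0) * (X p.2 + X p.1) ^ a p.2 := by
  rw [mon_update a p.2, map_mul, map_pow, subst_transvection_X, if_pos rfl, mon_eq_prod, map_prod]
  congr 1
  refine Finset.prod_congr rfl fun l _ => ?_
  rw [map_pow, subst_transvection_X]
  split_ifs with h
  · rw [h, Function.update_self, pow_zero, pow_zero]
  · rfl

/-- Moves `b` units of the exponent of `t_j` to `t_i`, where `p = (i, j)`. -/
def move (p : Fin 4 × Fin 4) (b : ℕ) (a : Fin 4 → ℕ) : Fin 4 → ℕ := fun l =>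
  bif decide (l = p.2) then a l - b else bif decide (l = p.1) then a l + b else a l

theorem move_snd (p : Fin 4 × Fin 4) (a : Fin 4 → ℕ) (b : ℕ) : move p b a p.2 = a p.2 - b := by
  simp [move]

theorem move_fst {p : Fin 4 × Fin 4} (hp : p.1 ≠ p.2) (a : Fin 4 → ℕ) (b : ℕ) :
    move p b a p.1 = a p.1 + b := by
  simp [move, hp]

theorem move_of_ne {p : Fin 4 × Fin 4} (a : Fin 4 → ℕ) (b : ℕ) {l : Fin 4} (h1 : l ≠ p.1)
    (h2 : l ≠ p.2) : move p b a l = a l := by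
  simp [move, h1, h2]

theorem mon_update_move {p : Fin 4 × Fin 4} (hp : p.1 ≠ p.2) (a : Fin 4 → ℕ) (b : ℕ) :
    (mon (Function.update (move p b a) p.2 0) : Poly 4)
      = mon (Function.update a p.2 0) * X p.1 ^ b := by
  rw [mon_update _ p.1, mon_update (Function.update a p.2 0) p.1, Function.update_of_ne hp,
    Function.update_of_ne hp, move_fst hp, pow_add, ← mul_assoc]
  congr 3
  ext l
  by_cases h1 : l = p.1
  · rw [h1, Function.update_self, Function.update_self]
  · rw [Function.update_of_ne h1, Function.update_of_ne h1]
    by_cases h2 : l = p.2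
    · rw [h2, Function.update_self, Function.update_self]
    · rw [Function.update_of_ne h2, Function.update_of_ne h2, move_of_ne a b h1 h2]

theorem mon_move {p : Fin 4 × Fin 4} (hp : p.1 ≠ p.2) (a : Fin 4 → ℕ) (b : ℕ) :
    (mon (move p b a) : Poly 4)
      = mon (Function.update a p.2 0) * X p.1 ^ b * X p.2 ^ (a p.2 - b) := by
  rw [mon_update _ p.2, mon_update_move hp, move_snd]

theorem sum_mul_move {p : Fin 4 × Fin 4} (hp : p.1 ≠ p.2) {a : Fin 4 → ℕ} {b : ℕ}
    (hb : b ≤ a p.2) (w : Fin 4 → ℕ) :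
    ∑ l, w l * move p b a l + b * w p.2 = ∑ l, w l * a l + b * w p.1 := by
  have h1 : ∀ l, w l * move p b a l + (if l = p.2 then b * w l else 0)
      = w l * a l + if l = p.1 then b * w l else 0 := by
    intro l
    by_cases h1 : l = p.2
    · subst h1
      rw [move_snd, if_pos rfl, if_neg hp.symm, mul_comm b, ← mul_add, Nat.sub_add_cancel hb,
        add_zero]
    · by_cases h2 : l = p.1
      · subst h2
        rw [move_fst hp, if_neg h1, if_pos rfl]
        ring
      · rw [move_of_ne a b h2 h1, if_neg h1, if_neg h2]
  have h2 := Finset.sum_congr rfl fun l (_ : l ∈ Finset.univ) => h1 l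
  simpa only [Finset.sum_add_distrib, Finset.sum_ite_eq', Finset.mem_univ, if_true] using h2

theorem sum_move {p : Fin 4 × Fin 4} (hp : p.1 ≠ p.2) {a : Fin 4 → ℕ} {b : ℕ} (hb : b ≤ a p.2) :
    ∑ l, move p b a l = ∑ l, a l := by
  simpa using sum_mul_move hp hb fun _ => 1

/-- The coefficients of `code`. -/
def weight : Fin 4 → ℕ := ![1, 39, 1521, 0]

theorem code_eq_sum (a : Fin 4 → ℕ) : code a = ∑ l, weight l * a l := by
  rw [Fin.sum_univ_four]
  simp [code, weight]

theorem code_move {p : Fin 4 × Fin 4} (hp : p.1 ≠ p.2) {a : Fin 4 → ℕ} {b : ℕ}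
    (hb : b ≤ a p.2) :
    code (move p b a) + b * weight p.2 = code a + b * weight p.1 := by
  rw [code_eq_sum, code_eq_sum, sum_mul_move hp hb]

/-! ### Transvections on bit masks -/

/-- The monomials of degree 38 for which the binary digit of place `s` is set in the exponent of
`t_i`. -/
def bitMask (i : Fin 4) (s : ℕ) : ℕ := mask i (fun v => v.testBit s) &&& full

theorem testBit_bitMask (i : Fin 4) (s : ℕ) {a : Fin 4 → ℕ} (ha : ∑ i, a i = 38) :
    (bitMask i s).testBit (code a) = (a i).testBit s := by
  rw [bitMask, Nat.testBit_and, testBit_mask i _ ha, full, testBit_mask 3 _ ha, Bool.and_true]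

/-- The part of a transvection that acts through the binary digit of place `s` of the exponent of
`t_j`, where `p = (i, j)`. -/
def shearStep (p : Fin 4 × Fin 4) (s N : ℕ) : ℕ :=
  N ^^^ (((N <<< (2 ^ s * weight p.2)) >>> (2 ^ s * weight p.1)) &&& bitMask p.2 s)

/-- The action of the transvection `t_j ↦ t_j + t_i` on bit masks, where `p = (i, j)`. The exponents
are below `2 ^ 6`. -/
def shear (p : Fin 4 × Fin 4) (N : ℕ) : ℕ :=
  [5, 4, 3, 2, 1, 0].foldr (shearStep p) N

theorem testBit_shearStep {p : Fin 4 × Fin 4} (hp : p.1 ≠ p.2) (s N : ℕ) {a : Fin 4 → ℕ}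
    (ha : ∑ i, a i = 38) :
    (shearStep p s N).testBit (code a) = (N.testBit (code a) ^^
      (N.testBit (code (move p (2 ^ s) a)) && (a p.2).testBit s)) := by
  rw [shearStep, Nat.testBit_xor, Nat.testBit_and, testBit_bitMask _ _ ha]
  by_cases h : (a p.2).testBit s = true
  · have hc := code_move hp (Nat.ge_two_pow_of_testBit h)
    rw [Nat.testBit_shiftRight, Nat.testBit_shiftLeft,
      show 2 ^ s * weight p.1 + code a - 2 ^ s * weight p.2 = code (move p (2 ^ s) a) by omega,
      decide_eq_true (by omega), Bool.true_and]
  · rw [Bool.eq_false_of_not_eq_true h, Bool.and_false, Bool.and_false]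

/-- The image of `t^a` under the substitution of `t_j + t_i` for `t_j`, applied only to the part of
the power of `t_j` that belongs to the `s` lowest binary digits of the exponent. -/
noncomputable def partialSubst (p : Fin 4 × Fin 4) (s : ℕ) (a : Fin 4 → ℕ) : Poly 4 :=
  mon (Function.update a p.2 0) * X p.2 ^ (a p.2 - a p.2 % 2 ^ s) *
    (X p.2 + X p.1) ^ (a p.2 % 2 ^ s)

theorem partialSubst_succ {p : Fin 4 × Fin 4} (hp : p.1 ≠ p.2) (s : ℕ) (a : Fin 4 → ℕ) :
    partialSubst p (s + 1) a = partialSubst p s a +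
      if (a p.2).testBit s then partialSubst p s (move p (2 ^ s) a) else 0 := by
  have h1 : a p.2 % 2 ^ (s + 1) = a p.2 % 2 ^ s + 2 ^ s * ((a p.2).testBit s).toNat := by
    rw [Nat.mod_pow_succ, Nat.toNat_testBit]
  unfold partialSubst
  rw [h1, mon_update_move hp, move_snd]
  have h4 := Nat.mod_le (a p.2) (2 ^ (s + 1))
  rw [h1] at h4
  generalize hn : a p.2 = n at *
  cases hb : n.testBit s
  · simp
  · rw [hb, Bool.toNat_true, mul_one] at h4
    have h2 : (n - 2 ^ s) % 2 ^ s = n % 2 ^ s := by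
      conv_rhs => rw [show n = n - 2 ^ s + 2 ^ s by omega]
      rw [Nat.add_mod_right]
    rw [if_pos rfl, h2, Bool.toNat_true, mul_one, pow_add (X p.2 + X p.1 : Poly 4),
      add_pow_char_pow, show n - n % 2 ^ s = n - (n % 2 ^ s + 2 ^ s) + 2 ^ s by omega,
      show n - 2 ^ s - n % 2 ^ s = n - (n % 2 ^ s + 2 ^ s) by omega]
    ring

theorem ext_partialSubst_succ {p : Fin 4 × Fin 4} (hp : p.1 ≠ p.2) {s N : ℕ}
    {φ : HomologyDeg 4 38}
    (h : ∀ a : Fin 4 → ℕ, ∑ i, a i = 38 →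
      ext φ (partialSubst p s a) = if N.testBit (code a) then 1 else 0)
    (a : Fin 4 → ℕ) (ha : ∑ i, a i = 38) :
    ext φ (partialSubst p (s + 1) a) = if (shearStep p s N).testBit (code a) then 1 else 0 := by
  rw [partialSubst_succ hp, map_add, testBit_shearStep hp s N ha, h a ha]
  by_cases hb : (a p.2).testBit s = true
  · rw [if_pos hb, hb, h _ ((sum_move hp (Nat.ge_two_pow_of_testBit hb)).trans ha)]
    cases N.testBit (code a) <;> cases N.testBit (code (move p (2 ^ s) a)) <;> decide
  · rw [if_neg hb, map_zero, add_zero, Bool.eq_false_of_not_eq_true hb, Bool.and_false,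
      Bool.xor_false]

theorem Represents.shear {p : Fin 4 × Fin 4} (hp : p.1 ≠ p.2) {N : ℕ} {φ : HomologyDeg 4 38}
    (h : Represents N φ) :
    Represents (shear p N) (homologyRep 4 38 (transvectionGL p hp) φ) := by
  have h0 : ∀ a : Fin 4 → ℕ, ∑ i, a i = 38 →
      ext φ (partialSubst p 0 a) = if N.testBit (code a) then 1 else 0 := fun a ha => by
    rw [← h a ha, partialSubst, pow_zero, Nat.mod_one, Nat.sub_zero, pow_zero, mul_one,
      ← mon_update]
  have h6 := ext_partialSubst_succ hp (ext_partialSubst_succ hp (ext_partialSubst_succ hp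
    (ext_partialSubst_succ hp (ext_partialSubst_succ hp (ext_partialSubst_succ hp h0)))))
  intro a ha
  rw [ext_homologyRep _ _ (mon_mem ha), subst_transvection_mon]
  have h7 : a p.2 < 2 ^ 6 := by
    have := Finset.single_le_sum (f := a) (fun i _ => Nat.zero_le _) (Finset.mem_univ p.2)
    rw [ha] at this
    omega
  have h8 := h6 a ha
  rw [partialSubst, Nat.mod_eq_of_lt h7, Nat.sub_self, pow_zero, mul_one] at h8
  exact h8

/-! ### Elements of the orbits -/

/-- Evaluation of `f` at `L`. In kernel reduction the recursion on `L` computes the spine of the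
list, and leaves its entries unevaluated, before `f` is unfolded. -/
def forceSpine {α : Type} (L : List ℕ) : (List ℕ → α) → α :=
  List.rec (fun f => f []) (fun N _ ih f => ih fun L => f (N :: L)) L

@[simp] theorem forceSpine_eq {α : Type} (L : List ℕ) (f : List ℕ → α) : forceSpine L f = f L := by
  induction L generalizing f with
  | nil => rfl
  | cons N L ih => exact ih fun L => f (N :: L)

/-- Membership in a list. -/
def memList (N : ℕ) : List ℕ → Bool
  | [] => false
  | M :: L => Nat.beq N M || memList N L

/-- The list `K` with those entries of `L` added that are not yet in it. -/
def insertNew : List ℕ → List ℕ → List ℕ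
  | [], K => K
  | N :: L, K => bif memList N K then insertNew L K else insertNew L (N :: K)

theorem mem_insertNew {N : ℕ} {L K : List ℕ} (h : N ∈ insertNew L K) : N ∈ L ∨ N ∈ K := by
  induction L generalizing K with
  | nil => exact Or.inr h
  | cons M L ih =>
    rw [insertNew] at h
    cases hM : memList M K
    · rw [hM, cond_false] at h
      rcases ih h with h | h
      · exact Or.inl (List.mem_cons_of_mem _ h)
      · rcases List.mem_cons.1 h with rfl | h
        · exact Or.inl List.mem_cons_self
        · exact Or.inr h
    · rw [hM, cond_true] at h
      exact (ih h).imp_left (List.mem_cons_of_mem _)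

/-- The images of the bit masks `L` under the ordered products of subsequences of a sequence of
transvections. -/
def orbit : List (Fin 4 × Fin 4) → List ℕ → List ℕ
  | [], L => L
  | p :: S, L => forceSpine (insertNew (L.map (shear p)) L) fun L => orbit S L

/-- The bit mask `N` represents an element of the `GL_4`-orbit of `ζ`. -/
def RepresentsInOrbit (ζ : HomologyDeg 4 38) (N : ℕ) : Prop :=
  ∃ g, Represents N (homologyRep 4 38 g ζ)

theorem representsInOrbit_of_mem_orbit {ζ : HomologyDeg 4 38} {S : List (Fin 4 × Fin 4)}
    (hS : ∀ p ∈ S, p.1 ≠ p.2) {L : List ℕ} (hL : ∀ N ∈ L, RepresentsInOrbit ζ N) :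
    ∀ N ∈ orbit S L, RepresentsInOrbit ζ N := by
  induction S generalizing L with
  | nil => exact hL
  | cons p S ih =>
    rw [orbit, forceSpine_eq]
    refine ih (fun q hq => hS q (List.mem_cons_of_mem _ hq)) fun N hN => ?_
    rcases mem_insertNew hN with h | h
    · obtain ⟨M, hM, rfl⟩ := List.mem_map.1 h
      obtain ⟨g, hg⟩ := hL M hM
      refine ⟨transvectionGL p (hS p List.mem_cons_self) * g, ?_⟩
      rw [map_mul, Module.End.mul_apply]
      exact hg.shear _
    · exact hL N h

/-- A sequence of transvections, as pairs `(i, j)` for `t_j ↦ t_j + t_i`. The products of its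
subsequences move `x_1^{(0)} x_2^{(0)} x_3^{(7)} x_4^{(31)}` to enough elements to span the
submodule that it generates. -/
def spikeWord : List (Fin 4 × Fin 4) :=
  [(2, 1), (1, 0), (3, 1), (3, 2), (3, 0), (1, 3), (0, 1), (2, 3), (0, 2), (1, 2)]

/-- A sequence of transvections, as in `spikeWord`, for the orbit of `ζ̃`. -/
def zetaWord : List (Fin 4 × Fin 4) :=
  [(1, 2), (0, 3), (1, 0), (3, 1), (2, 3), (0, 2), (2, 0), (3, 2)]

/-- Bit masks of elements of the orbits of the two classes that together span the `Ā`-annihilated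
classes of degree 38. -/
def generators : List ℕ :=
  orbit spikeWord [maskOf [![0, 0, 7, 31]]] ++ orbit zetaWord [maskOf zetaExponents]

theorem representsInOrbit_of_mem_generators {N : ℕ} (hN : N ∈ generators) :
    RepresentsInOrbit (dpMonomial 4 38 ![0, 0, 7, 31]) N ∨ RepresentsInOrbit zetaTilde N := by
  have h1 : RepresentsInOrbit (dpMonomial 4 38 ![0, 0, 7, 31]) (maskOf [![0, 0, 7, 31]]) :=
    ⟨1, by
      rw [map_one]
      simpa using represents_maskOf (L := [![0, 0, 7, 31]]) (sum_eq_of_all (by decide))⟩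
  have h2 : RepresentsInOrbit zetaTilde (maskOf zetaExponents) := by
    have h := represents_maskOf (sum_eq_of_all (L := zetaExponents) (by decide +kernel))
    refine ⟨1, ?_⟩
    rw [map_one, Module.End.one_apply, zetaTilde]
    -- The list is generalized so that comparing the types does not evaluate it.
    generalize zetaExponents = L at h ⊢
    exact h
  rcases List.mem_append.1 hN with h | h
  · exact Or.inl (representsInOrbit_of_mem_orbit (by decide)
      (fun M hM => (List.mem_singleton.1 hM) ▸ h1) N h)
  · exact Or.inr (representsInOrbit_of_mem_orbit (by decide)
      (fun M hM => (List.mem_singleton.1 hM) ▸ h2) N h)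

/-! ### Elimination -/

section elimination

variable {V : Type*} [AddCommGroup V] [Module (ZMod 2) V]

/-- The bits of `r` are the coordinates `ℓ` of `v`. -/
def HasCoordinates (ℓ : ℕ → V →ₗ[ZMod 2] ZMod 2) (r : ℕ) (v : V) : Prop :=
  ∀ i, ℓ i v = if r.testBit i then 1 else 0

/-- Row reduction: adds `r` to the rows in which the bit `c` is set, and removes copies of `r`. -/
def clearBit (c r : ℕ) : List ℕ → List ℕ
  | [] => []
  | N :: L => bif N.testBit c then
      (bif Nat.beq N r then clearBit c r L else (N ^^^ r) :: clearBit c r L)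
    else N :: clearBit c r L

theorem mem_clearBit {c r N : ℕ} {L : List ℕ} (h : N ∈ clearBit c r L) :
    (N.testBit c = false ∧ N ∈ L) ∨ ∃ M ∈ L, M.testBit c = true ∧ N = M ^^^ r := by
  induction L with
  | nil => simp [clearBit] at h
  | cons M L ih =>
    have h1 : N ∈ clearBit c r L → (N.testBit c = false ∧ N ∈ M :: L) ∨
        ∃ M' ∈ M :: L, M'.testBit c = true ∧ N = M' ^^^ r := fun h => by
      rcases ih h with h | ⟨M', h, h'⟩
      · exact Or.inl ⟨h.1, List.mem_cons_of_mem _ h.2⟩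
      · exact Or.inr ⟨M', List.mem_cons_of_mem _ h, h'⟩
    rw [clearBit] at h
    cases hM : M.testBit c <;> rw [hM] at h
    · rcases List.mem_cons.1 h with rfl | h
      · exact Or.inl ⟨hM, List.mem_cons_self⟩
      · exact h1 h
    · rw [cond_true] at h
      cases hr : Nat.beq M r <;> rw [hr] at h
      · rcases List.mem_cons.1 h with rfl | h
        · exact Or.inr ⟨M, List.mem_cons_self, hM, rfl⟩
        · exact h1 h
      · exact h1 h

/-- The set of the pivots found in at most `n` steps of Gaussian elimination on the rows. -/
def pivots : ℕ → List ℕ → ℕ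
  | 0, _ => 0
  | _, [] => 0
  | n + 1, r :: L => force (Nat.log2 r) fun c =>
      bif r.testBit c then forceSpine (clearBit c r L) fun L => 1 <<< c ||| pivots n L
      else pivots n L

/-- If the rows are the coordinates of vectors in `W`, then every vector can be changed by an
element of `W` so that its coordinates at the pivots vanish. -/
theorem exists_coordinates_eq_zero {ℓ : ℕ → V →ₗ[ZMod 2] ZMod 2} (n : ℕ) {R : List ℕ}
    {W : Submodule (ZMod 2) V} (hR : ∀ r ∈ R, ∃ v ∈ W, HasCoordinates ℓ r v) (v : V) :
    ∃ w ∈ W, ∀ i, (pivots n R).testBit i = true → ℓ i (v - w) = 0 := by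
  induction n generalizing R W v with
  | zero => exact ⟨0, W.zero_mem, fun i hi => by simp [pivots] at hi⟩
  | succ n ih =>
    cases R with
    | nil => exact ⟨0, W.zero_mem, fun i hi => by simp [pivots] at hi⟩
    | cons r L =>
      rw [pivots, force_eq]
      generalize Nat.log2 r = c
      cases hc : r.testBit c
      · exact ih (fun r hr => hR r (List.mem_cons_of_mem _ hr)) v
      · rw [cond_true, forceSpine_eq]
        obtain ⟨u, hu, hru⟩ := hR r List.mem_cons_self
        have huc : ℓ c u = 1 := by rw [hru, hc, if_pos rfl]
        -- The reduced rows represent vectors of `W` on which the coordinate `c` vanishes.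
        have hL : ∀ s ∈ clearBit c r L, ∃ x ∈ W ⊓ LinearMap.ker (ℓ c), HasCoordinates ℓ s x := by
          intro s hs
          rcases mem_clearBit hs with ⟨h1, h2⟩ | ⟨M, h1, h2, rfl⟩
          · obtain ⟨x, hx, hsx⟩ := hR s (List.mem_cons_of_mem _ h2)
            refine ⟨x, ⟨hx, ?_⟩, hsx⟩
            rw [SetLike.mem_coe, LinearMap.mem_ker, hsx, h1, if_neg Bool.false_ne_true]
          · obtain ⟨x, hx, hMx⟩ := hR M (List.mem_cons_of_mem _ h1)
            refine ⟨x + u, ⟨W.add_mem hx hu, ?_⟩, fun i => ?_⟩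
            · rw [SetLike.mem_coe, LinearMap.mem_ker, map_add, hMx, h2, huc]
              rfl
            · rw [map_add, hMx, hru, Nat.testBit_xor]
              cases M.testBit i <;> cases r.testBit i <;> decide
        obtain ⟨w, hw, hi⟩ := ih hL (v - ℓ c v • u)
        refine ⟨ℓ c v • u + w, W.add_mem (W.smul_mem _ hu) hw.1, fun i hp => ?_⟩
        rw [← sub_sub]
        rw [Nat.testBit_or, testBit_one_shiftLeft, Bool.or_eq_true, decide_eq_true_eq] at hp
        rcases hp with rfl | hp
        · rw [map_sub, map_sub, map_smul, huc, (LinearMap.mem_ker).1 hw.2, smul_eq_mul, mul_one,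
            sub_self, sub_zero]
        · exact hi i hp

end elimination

/-! ### The span of the two orbits -/

/-- The values of a bit mask on a list of monomials, packed into a number. -/
def readOff (N : ℕ) : List (Fin 4 → ℕ) → ℕ
  | [] => 0
  | a :: L => 2 * readOff N L + (N >>> code a) % 2

/-- `readOff` on the entries of a list. -/
def readOffs (B : List (Fin 4 → ℕ)) : List ℕ → List ℕ
  | [] => []
  | N :: L => force (readOff N B) fun M => M :: readOffs B L

theorem readOffs_eq (B : List (Fin 4 → ℕ)) (L : List ℕ) :
    readOffs B L = L.map fun N => readOff N B := by
  induction L with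
  | nil => rfl
  | cons N L ih => rw [readOffs, force_eq, ih, List.map_cons]

/-- The values of a homology class on a list of monomials. -/
noncomputable def coordinate (B : List (Fin 4 → ℕ)) (i : ℕ) : HomologyDeg 4 38 →ₗ[ZMod 2] ZMod 2 :=
  match B, i with
  | [], _ => 0
  | a :: _, 0 =>
    { toFun := fun φ => ext φ (mon a)
      map_add' := fun _ _ => rfl
      map_smul' := fun _ _ => rfl }
  | _ :: B, i + 1 => coordinate B i

theorem Represents.hasCoordinates {N : ℕ} {φ : HomologyDeg 4 38} (h : Represents N φ)
    {B : List (Fin 4 → ℕ)} (hB : ∀ a ∈ B, ∑ i, a i = 38) :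
    HasCoordinates (coordinate B) (readOff N B) φ := by
  induction B with
  | nil => exact fun i => by simp [coordinate, readOff]
  | cons a B ih =>
    have h1 : (N >>> code a) % 2 = (N.testBit (code a)).toNat := by
      rw [Nat.toNat_testBit, Nat.shiftRight_eq_div_pow]
    intro i
    rw [readOff, h1]
    cases i with
    | zero =>
      refine (h a (hB a List.mem_cons_self)).trans ?_
      rw [Nat.testBit_zero]
      cases N.testBit (code a) <;> simp
    | succ i =>
      refine (ih (fun m hm => hB m (List.mem_cons_of_mem _ hm)) i).trans ?_
      rw [Nat.testBit_succ]
      have h2 : (2 * readOff N B + (N.testBit (code a)).toNat) / 2 = readOff N B := by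
        have := Bool.toNat_lt (N.testBit (code a))
        omega
      rw [h2]

theorem ext_eq_zero_of_coordinate {B : List (Fin 4 → ℕ)} {φ : HomologyDeg 4 38}
    (h : ∀ i < B.length, coordinate B i φ = 0) : ∀ a ∈ B, ext φ (mon a) = 0 := by
  induction B with
  | nil => simp
  | cons b B ih =>
    intro a ha
    rcases List.mem_cons.1 ha with rfl | ha
    · exact h 0 (by simp)
    · exact ih (fun i hi => h (i + 1) (by simpa using hi)) a ha

/-- Whether the bit masks `L`, restricted to the monomials `B`, have rank `B.length`. -/
def rankTest (B : List (Fin 4 → ℕ)) (L : List ℕ) : Bool :=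
  Nat.beq (pivots L.length (readOffs B L)) (2 ^ B.length - 1)

theorem exists_ext_sub_eq_zero {B : List (Fin 4 → ℕ)} (hB : ∀ a ∈ B, ∑ i, a i = 38) {L : List ℕ}
    (hL : rankTest B L = true) {W : Submodule (ZMod 2) (HomologyDeg 4 38)}
    (hW : ∀ N ∈ L, ∃ ψ ∈ W, Represents N ψ) (φ : HomologyDeg 4 38) :
    ∃ w ∈ W, ∀ a ∈ B, ext (φ - w) (mon a) = 0 := by
  have hR : ∀ r ∈ readOffs B L, ∃ ψ ∈ W, HasCoordinates (coordinate B) r ψ := by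
    intro r hr
    rw [readOffs_eq] at hr
    obtain ⟨N, hN, rfl⟩ := List.mem_map.1 hr
    obtain ⟨ψ, hψ, h⟩ := hW N hN
    exact ⟨ψ, hψ, h.hasCoordinates hB⟩
  obtain ⟨w, hw, h⟩ := exists_coordinates_eq_zero L.length hR φ
  refine ⟨w, hw, ext_eq_zero_of_coordinate fun i hi => h i ?_⟩
  rw [rankTest, Nat.beq_eq] at hL
  rw [hL, Nat.testBit_two_pow_sub_one, decide_eq_true_eq]
  exact hi

/-- The `Ā`-annihilated classes that are represented by the entries of a list of bit masks. -/
def representedClasses (L : List ℕ) : Set (HomologyDeg 4 38) :=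
  {φ | φ ∈ annihilated 4 38 ∧ ∃ N ∈ L, Represents N φ}

theorem annihilated_le_span_of_rankTest {L : List ℕ} (hL : rankTest basisExponents L = true)
    (hann : ∀ N ∈ L, ∃ ψ ∈ annihilated 4 38, Represents N ψ) :
    annihilated 4 38 ≤ Submodule.span (ZMod 2) (representedClasses L) := by
  have hle : Submodule.span (ZMod 2) (representedClasses L) ≤ annihilated 4 38 :=
    Submodule.span_le.2 fun φ hφ => hφ.1
  intro φ hφ
  obtain ⟨w, hw, h⟩ := exists_ext_sub_eq_zero sum_basisExponents hL
    (W := Submodule.span (ZMod 2) (representedClasses L)) (fun N hN => by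
      obtain ⟨ψ, hψ, hN'⟩ := hann N hN
      exact ⟨ψ, Submodule.subset_span ⟨hψ, N, hN, hN'⟩, hN'⟩) φ
  have h0 : φ - w = 0 :=
    eq_zero_of_basisExponents ((annihilated 4 38).sub_mem hφ (hle hw)) h
  rwa [sub_eq_zero.1 h0]

theorem rankTest_generators : rankTest basisExponents generators = true := by
  decide +kernel

/-- The `Ā`-annihilated classes of degree 38 are spanned by the orbits of the two classes: a
combination of the generators matches a given class on `basisExponents`, and then the two are
equal. -/
theorem annihilated_le_span :
    annihilated 4 38 ≤ Submodule.span (ZMod 2) (representedClasses generators) := by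
  refine annihilated_le_span_of_rankTest rankTest_generators fun N hN => ?_
  rcases representsInOrbit_of_mem_generators hN with ⟨g, hg⟩ | ⟨g, hg⟩
  · exact ⟨_, homologyRep_mem_annihilated g spike_mem, hg⟩
  · exact ⟨_, homologyRep_mem_annihilated g zetaTilde_mem, hg⟩

/-! ### Invariant functionals -/

/-- The exponents of the images of `t^a` under the substitution of `t_j + t_i` for `t_j`, where
`p = (i, j)`. -/
def expand (p : Fin 4 × Fin 4) (a : Fin 4 → ℕ) : List (Fin 4 → ℕ) :=
  ((List.range (a p.2 + 1)).filter fun b => Nat.beq (a p.2 &&& b) b).map fun b => move p b a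

theorem list_sum_map_filter_range {M : Type*} [AddCommMonoid M] (n : ℕ) (P : ℕ → Bool)
    (f : ℕ → M) :
    (((List.range n).filter P).map f).sum = ∑ b ∈ Finset.range n, if P b then f b else 0 := by
  induction n with
  | zero => rfl
  | succ n ih =>
    rw [List.range_succ, List.filter_append, List.map_append, List.sum_append, ih,
      Finset.sum_range_succ]
    cases h : P n <;> simp [h]

theorem subst_transvection_mon_eq_sum (p : Fin 4 × Fin 4) (hp : p.1 ≠ p.2) (a : Fin 4 → ℕ) :
    subst 4 (transvectionGL p hp).1 (mon a) = ((expand p a).map mon).sum := by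
  rw [subst_transvection_mon, expand, List.map_map, list_sum_map_filter_range, add_comm (X p.2),
    add_pow, Finset.mul_sum]
  refine Finset.sum_congr rfl fun b _ => ?_
  have h1 : (((a p.2).choose b : ℕ) : Poly 4) = if a p.2 &&& b = b then 1 else 0 := by
    rw [← map_natCast (C : ZMod 2 →+* Poly 4), natCast_choose_zmod_two, apply_ite C, C_1, C_0]
  rw [h1, Function.comp_apply, mon_move hp]
  by_cases h : a p.2 &&& b = b
  · rw [if_pos h, if_pos (by rw [Nat.beq_eq]; exact h), mul_one, ← mul_assoc]
  · rw [if_neg h, if_neg (by rw [Nat.beq_eq]; exact h), mul_zero, mul_zero]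

/-- Exclusive or of the two halves of the `2 ^ (k + 1)` lowest bits. -/
def foldBits (k N : ℕ) : ℕ := (N >>> 2 ^ k) ^^^ (N % 2 ^ 2 ^ k)

/-- The parity of the number of ones among the `2 ^ k` lowest bits. -/
def parityOfBits : ℕ → ℕ → Bool
  | 0, N => N.testBit 0
  | k + 1, N => parityOfBits k (foldBits k N)

theorem foldBits_xor (k M N : ℕ) : foldBits k (M ^^^ N) = foldBits k M ^^^ foldBits k N := by
  simp only [foldBits, Nat.shiftRight_xor_distrib, Nat.xor_mod_two_pow]
  ac_rfl

theorem parityOfBits_xor (k M N : ℕ) :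
    parityOfBits k (M ^^^ N) = (parityOfBits k M ^^ parityOfBits k N) := by
  induction k generalizing M N with
  | zero => exact Nat.testBit_xor M N 0
  | succ k ih => rw [parityOfBits, foldBits_xor, ih, parityOfBits, parityOfBits]

theorem parityOfBits_zero (k : ℕ) : parityOfBits k 0 = false := by
  have h := parityOfBits_xor k 0 0
  rwa [Nat.xor_self, Bool.xor_self] at h

theorem parityOfBits_one_shiftLeft {k c : ℕ} (hc : c < 2 ^ k) :
    parityOfBits k (1 <<< c) = true := by
  induction k generalizing c with
  | zero =>
    rw [pow_zero, Nat.lt_one_iff] at hc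
    subst hc
    rfl
  | succ k ih =>
    rw [pow_succ] at hc
    rw [parityOfBits, foldBits, Nat.one_shiftLeft, Nat.shiftRight_eq_div_pow]
    rcases Nat.lt_or_ge c (2 ^ k) with h | h
    · have h2 : 2 ^ c < 2 ^ 2 ^ k := Nat.pow_lt_pow_right one_lt_two h
      rw [Nat.div_eq_of_lt h2, Nat.mod_eq_of_lt h2, Nat.zero_xor, ← Nat.one_shiftLeft]
      exact ih h
    · rw [Nat.mod_eq_zero_of_dvd (pow_dvd_pow 2 h), Nat.xor_zero, Nat.pow_div h two_pos,
        ← Nat.one_shiftLeft]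
      exact ih (by omega)

theorem code_lt {a : Fin 4 → ℕ} (ha : ∑ i, a i = 38) : code a < 2 ^ 16 := by
  rw [Fin.sum_univ_four] at ha
  unfold code
  omega

theorem parityOfBits_and_maskOf {N : ℕ} {φ : HomologyDeg 4 38} (h : Represents N φ)
    {L : List (Fin 4 → ℕ)} (hL : ∀ m ∈ L, ∑ i, m i = 38) :
    ext φ (L.map mon).sum = if parityOfBits 16 (N &&& maskOf L) then 1 else 0 := by
  induction L with
  | nil =>
    rw [List.map_nil, List.sum_nil, map_zero, maskOf, List.foldr_nil, Nat.and_zero,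
      parityOfBits_zero]
    rfl
  | cons m L ih =>
    have hm := hL m List.mem_cons_self
    rw [List.map_cons, List.sum_cons, map_add, ih fun m hm => hL m (List.mem_cons_of_mem _ hm),
      h m hm]
    change _ = if parityOfBits 16 (N &&& (1 <<< code m ^^^ maskOf L)) then 1 else 0
    rw [Nat.and_xor_distrib_left, parityOfBits_xor]
    have h1 : N &&& 1 <<< code m = if N.testBit (code m) then 1 <<< code m else 0 := by
      rw [Nat.one_shiftLeft, Nat.and_two_pow]
      cases N.testBit (code m) <;> simp
    rw [h1]
    cases N.testBit (code m)
    · rw [if_neg Bool.false_ne_true, if_neg Bool.false_ne_true, parityOfBits_zero, zero_add,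
        Bool.false_xor]
    · rw [if_pos rfl, if_pos rfl, parityOfBits_one_shiftLeft (code_lt hm)]
      cases parityOfBits 16 (N &&& maskOf L) <;> decide

/-- The pairs of distinct indices. -/
def transvectionIndices : List (Fin 4 × Fin 4) :=
  [(0, 1), (0, 2), (0, 3), (1, 0), (1, 2), (1, 3), (2, 0), (2, 1), (2, 3), (3, 0), (3, 1), (3, 2)]

/-- Whether all entries of `L` take the value zero on `f · g - f` for all elementary transvections
`g`, where `f` is the sum of the monomials with exponents `F`. -/
def invarianceTest (F : List (Fin 4 → ℕ)) (L : List ℕ) : Bool :=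
  forceSpine L fun L => transvectionIndices.all fun p =>
    force (maskOf (F ++ F.flatMap (expand p))) fun D => L.all fun N => !parityOfBits 16 (N &&& D)

theorem sum_of_mem_expand {p : Fin 4 × Fin 4} (hp : p.1 ≠ p.2) {a m : Fin 4 → ℕ}
    (hm : m ∈ expand p a) : ∑ i, m i = ∑ i, a i := by
  obtain ⟨b, hb, rfl⟩ := List.mem_map.1 hm
  refine sum_move hp ?_
  have := (List.mem_filter.1 hb).1
  rw [List.mem_range] at this
  omega

theorem ext_subst_transvection {F : List (Fin 4 → ℕ)} (hF : ∀ m ∈ F, ∑ i, m i = 38) {L : List ℕ}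
    (h : invarianceTest F L = true) {φ : HomologyDeg 4 38}
    (hφ : φ ∈ Submodule.span (ZMod 2) (representedClasses L)) (p : Fin 4 × Fin 4)
    (hp : p.1 ≠ p.2) :
    ext φ (subst 4 (transvectionGL p hp).1 (F.map mon).sum) = ext φ (F.map mon).sum := by
  rw [invarianceTest, forceSpine_eq] at h
  have hp' : p ∈ transvectionIndices := by
    revert p
    decide
  have h1 := List.all_eq_true.1 h p hp'
  rw [force_eq] at h1
  have h2 : subst 4 (transvectionGL p hp).1 (F.map mon).sum
      = ((F.flatMap (expand p)).map mon).sum := by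
    clear h1 h hF
    induction F with
    | nil => rw [List.flatMap_nil, List.map_nil, List.sum_nil, map_zero]
    | cons a F ih =>
      rw [List.map_cons, List.sum_cons, map_add, ih, List.flatMap_cons, List.map_append,
        List.sum_append, subst_transvection_mon_eq_sum p hp]
  have h3 : ∀ m ∈ F ++ F.flatMap (expand p), ∑ i, m i = 38 := by
    intro m hm
    rcases List.mem_append.1 hm with hm | hm
    · exact hF m hm
    · obtain ⟨a, ha, hm⟩ := List.mem_flatMap.1 hm
      rw [sum_of_mem_expand hp hm, hF a ha]
  have h4 : ext φ ((F ++ F.flatMap (expand p)).map mon).sum = 0 := by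
    refine Submodule.span_induction
      (p := fun φ _ => ext φ ((F ++ F.flatMap (expand p)).map mon).sum = 0) ?_ rfl ?_ ?_ hφ
    · rintro ψ ⟨-, N, hN, hψ⟩
      have h5 := List.all_eq_true.1 h1 N hN
      rw [parityOfBits_and_maskOf hψ h3, if_neg]
      simpa using h5
    · intro x y _ _ hx hy
      rw [ext_add, hx, hy, add_zero]
    · intro c x _ hx
      rw [ext_smul, hx, mul_zero]
  rw [List.map_append, List.sum_append, map_add, ← h2] at h4
  exact (CharTwo.add_eq_zero.1 h4).symm

/-- A functional on the `Ā`-annihilated classes that is invariant under elementary transvections is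
invariant under `GL_4`: over `ℤ/2` every invertible matrix is a product of transvections. -/
theorem ext_homologyRep_eq_of_transvection {f : Poly 4} (hf : f ∈ PolyDeg 4 38)
    (H : ∀ φ ∈ annihilated 4 38, ∀ (p : Fin 4 × Fin 4) (hp : p.1 ≠ p.2),
      ext φ (subst 4 (transvectionGL p hp).1 f) = ext φ f)
    (g : Matrix.GeneralLinearGroup (Fin 4) (ZMod 2)) {φ : HomologyDeg 4 38}
    (hφ : φ ∈ annihilated 4 38) : ext (homologyRep 4 38 g φ) f = ext φ f := by
  rw [ext_homologyRep g φ hf]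
  have hdet : g.1.det ≠ 0 := (g.1.isUnit_iff_isUnit_det.1 g.isUnit).ne_zero
  revert φ
  refine Matrix.diagonal_transvection_induction_of_det_ne_zero
    (fun M => ∀ {φ}, φ ∈ annihilated 4 38 → ext φ (subst 4 M f) = ext φ f) g.1 hdet ?_ ?_ ?_
  · intro D hD φ _
    have h1 : Matrix.diagonal D = 1 := by
      rw [Matrix.det_diagonal] at hD
      rw [← Matrix.diagonal_one]
      congr 1
      ext i
      have h2 := Finset.prod_ne_zero_iff.1 hD i (Finset.mem_univ i)
      have h3 : ∀ x : ZMod 2, x ≠ 0 → x = 1 := by decide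
      rw [h3 _ h2]
    rw [h1, subst_one]
    rfl
  · intro t φ hφ
    have h3 : ∀ x : ZMod 2, x = 0 ∨ x = 1 := by decide
    rcases h3 t.c with hc | hc
    · have h1 : t.toMatrix = 1 := by
        rw [Matrix.TransvectionStruct.toMatrix, hc, Matrix.transvection_zero]
      rw [h1, subst_one]
      rfl
    · have h1 : t.toMatrix = (transvectionGL (t.j, t.i) t.hij.symm).1 := by
        rw [Matrix.TransvectionStruct.toMatrix, hc]
        rfl
      rw [h1]
      exact H φ hφ _ _
  · intro A B hA hB h1 h2 φ hφ
    rw [subst_mul, AlgHom.comp_apply]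
    have h3 := ext_homologyRep (Matrix.GeneralLinearGroup.mkOfDetNeZero B hB) φ
      (subst_isHomogeneous A hf)
    have h4 := ext_homologyRep (Matrix.GeneralLinearGroup.mkOfDetNeZero B hB) φ hf
    change _ = ext φ (subst 4 B (subst 4 A f)) at h3
    change _ = ext φ (subst 4 B f) at h4
    rw [← h3, h1 (homologyRep_mem_annihilated _ hφ), h4, h2 hφ]

/-- The exponents of the 16 monomials in a second invariant polynomial, in the sense of
`spikeDualExponents`. Its value is `0` on the orbit of `x_1^{(0)} x_2^{(0)} x_3^{(7)} x_4^{(31)}`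
and `1` on the orbit of `ζ̃`. -/
def zetaDualExponents : List (Fin 4 → ℕ) :=
  [![1, 1, 6, 30], ![1, 1, 14, 22], ![1, 2, 5, 30], ![1, 2, 29, 6], ![1, 3, 6, 28],
    ![1, 3, 28, 6], ![3, 1, 12, 22], ![3, 1, 14, 20], ![3, 3, 3, 29], ![3, 3, 29, 3],
    ![3, 7, 3, 25], ![3, 7, 25, 3], ![7, 3, 3, 25], ![7, 3, 25, 3], ![7, 11, 3, 17],
    ![7, 11, 17, 3]]

theorem invarianceTest_spikeDual : invarianceTest spikeDualExponents generators = true := by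
  decide +kernel

theorem invarianceTest_zetaDual : invarianceTest zetaDualExponents generators = true := by
  decide +kernel

/-! ### Coinvariants -/

theorem annClass_homologyRep {h n : ℕ} (g : Matrix.GeneralLinearGroup (Fin h) (ZMod 2))
    {φ : HomologyDeg h n} (hφ : φ ∈ annihilated h n) :
    annClass h n (homologyRep h n g φ) (homologyRep_mem_annihilated g hφ) = annClass h n φ hφ :=
  Representation.Coinvariants.mk_self_apply (annihilatedRep h n) g ⟨φ, hφ⟩

/-- A bit mask represents at most one homology class. -/
theorem Represents.unique {N : ℕ} {φ ψ : HomologyDeg 4 38} (hφ : Represents N φ)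
    (hψ : Represents N ψ) : φ = ψ :=
  sub_eq_zero.1 <| eq_zero_of_ext fun a ha => by rw [ext_sub, hφ a ha, hψ a ha, sub_self]

theorem annClass_eq_of_representsInOrbit {ζ : HomologyDeg 4 38} (hζ : ζ ∈ annihilated 4 38) {N : ℕ}
    (h : RepresentsInOrbit ζ N) {ψ : HomologyDeg 4 38} (hψ : ψ ∈ annihilated 4 38)
    (hN : Represents N ψ) : annClass 4 38 ψ hψ = annClass 4 38 ζ hζ := by
  obtain ⟨g, hg⟩ := h
  obtain rfl := hN.unique hg
  exact annClass_homologyRep g hζ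

theorem span_annClass_eq_top :
    Submodule.span (ZMod 2) {annClass 4 38 (dpMonomial 4 38 ![0, 0, 7, 31]) spike_mem,
      annClass 4 38 zetaTilde zetaTilde_mem} = ⊤ := by
  set U := Submodule.span (ZMod 2) {annClass 4 38 (dpMonomial 4 38 ![0, 0, 7, 31]) spike_mem,
    annClass 4 38 zetaTilde zetaTilde_mem} with hU
  have h1 : annihilated 4 38 ≤
      (U.comap (Representation.Coinvariants.mk (annihilatedRep 4 38))).map
        (annihilated 4 38).subtype := by
    refine annihilated_le_span.trans (Submodule.span_le.2 ?_)
    rintro ψ ⟨hψ, N, hN, hNψ⟩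
    refine ⟨⟨ψ, hψ⟩, ?_, rfl⟩
    change annClass 4 38 ψ hψ ∈ U
    rcases representsInOrbit_of_mem_generators hN with h | h
    · rw [annClass_eq_of_representsInOrbit spike_mem h hψ hNψ]
      exact Submodule.subset_span (Or.inl rfl)
    · rw [annClass_eq_of_representsInOrbit zetaTilde_mem h hψ hNψ]
      exact Submodule.subset_span (Or.inr rfl)
  refine Submodule.eq_top_iff'.2 fun x => ?_
  obtain ⟨φ, rfl⟩ := Representation.Coinvariants.mk_surjective _ x
  obtain ⟨ψ, hψ, h2⟩ := h1 φ.2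
  rwa [← Subtype.ext h2]

/-- The functional on the coinvariants given by evaluation at the sum of the monomials with
exponents `F`, provided that the invariance test for `F` succeeds. -/
theorem exists_functional {F : List (Fin 4 → ℕ)} (hF : ∀ m ∈ F, ∑ i, m i = 38)
    (h : invarianceTest F generators = true) :
    ∃ Λ : AnnCoinvariants 4 38 →ₗ[ZMod 2] ZMod 2, ∀ φ (hφ : φ ∈ annihilated 4 38),
      Λ (annClass 4 38 φ hφ) = ext φ (F.map mon).sum := by
  have hmem : (F.map mon).sum ∈ PolyDeg 4 38 := list_sum_mem fun f hf => by
    obtain ⟨a, ha, rfl⟩ := List.mem_map.1 hf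
    exact mon_mem (hF a ha)
  refine ⟨Representation.Coinvariants.lift (annihilatedRep 4 38)
    { toFun := fun φ => ext φ.1 (F.map mon).sum
      map_add' := fun _ _ => rfl
      map_smul' := fun _ _ => rfl } fun g => LinearMap.ext fun φ => ?_, fun φ hφ => rfl⟩
  exact ext_homologyRep_eq_of_transvection hmem
    (fun ψ hψ p hp => ext_subst_transvection hF h (annihilated_le_span hψ) p hp) g φ.2

theorem ext_sum_mon {L F : List (Fin 4 → ℕ)} (hL : ∀ m ∈ L, ∑ i, m i = 38)
    (hF : ∀ m ∈ F, ∑ i, m i = 38) :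
    ext (L.map (dpMonomial 4 38)).sum (F.map mon).sum =
      if parityOfBits 16 (maskOf L &&& maskOf F) then 1 else 0 :=
  parityOfBits_and_maskOf (represents_maskOf hL) hF

theorem ext_zetaTilde {F : List (Fin 4 → ℕ)} (hF : ∀ m ∈ F, ∑ i, m i = 38) :
    ext zetaTilde (F.map mon).sum =
      if parityOfBits 16 (maskOf zetaExponents &&& maskOf F) then 1 else 0 := by
  have h := ext_sum_mon (sum_eq_of_all (L := zetaExponents) (by decide +kernel)) hF
  rw [zetaTilde]
  -- The list is generalized so that comparing the types does not evaluate it.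
  generalize zetaExponents = L at h ⊢
  exact h

theorem ext_spike {F : List (Fin 4 → ℕ)} (hF : ∀ m ∈ F, ∑ i, m i = 38) :
    ext (dpMonomial 4 38 ![0, 0, 7, 31]) (F.map mon).sum =
      if parityOfBits 16 (maskOf [![0, 0, 7, 31]] &&& maskOf F) then 1 else 0 := by
  simpa using ext_sum_mon (L := [![0, 0, 7, 31]]) (sum_eq_of_all (by decide)) hF

theorem linearIndependent_annClass :
    LinearIndependent (ZMod 2) ![annClass 4 38 (dpMonomial 4 38 ![0, 0, 7, 31]) spike_mem,
      annClass 4 38 zetaTilde zetaTilde_mem] := by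
  have h1 := sum_eq_of_all (L := spikeDualExponents) (by decide +kernel)
  have h2 := sum_eq_of_all (L := zetaDualExponents) (by decide +kernel)
  obtain ⟨Λ₁, hΛ₁⟩ := exists_functional h1 invarianceTest_spikeDual
  obtain ⟨Λ₂, hΛ₂⟩ := exists_functional h2 invarianceTest_zetaDual
  have e11 : Λ₁ (annClass 4 38 (dpMonomial 4 38 ![0, 0, 7, 31]) spike_mem) = 1 :=
    (hΛ₁ _ _).trans <| (ext_spike h1).trans <| if_pos (by decide +kernel)
  have e12 : Λ₁ (annClass 4 38 zetaTilde zetaTilde_mem) = 0 :=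
    (hΛ₁ _ _).trans <| (ext_zetaTilde h1).trans <| if_neg (by decide +kernel)
  have e22 : Λ₂ (annClass 4 38 zetaTilde zetaTilde_mem) = 1 :=
    (hΛ₂ _ _).trans <| (ext_zetaTilde h2).trans <| if_pos (by decide +kernel)
  have e21 : Λ₂ (annClass 4 38 (dpMonomial 4 38 ![0, 0, 7, 31]) spike_mem) = 0 :=
    (hΛ₂ _ _).trans <| (ext_spike h2).trans <| if_neg (by decide +kernel)
  refine LinearIndependent.pair_iff.2 fun s t hst => ⟨?_, ?_⟩
  · simpa [e11, e12] using congrArg Λ₁ hst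
  · simpa [e21, e22] using congrArg Λ₂ hst

end SteenrodHomology

theorem mainTheorem2 :
    ∃ (h₁ : SteenrodHomology.dpMonomial 4 38 ![0, 0, 7, 31] ∈ SteenrodHomology.annihilated 4 38)
      (h₂ : SteenrodHomology.zetaTilde ∈ SteenrodHomology.annihilated 4 38),
      Module.finrank (ZMod 2) (SteenrodHomology.AnnCoinvariants 4 38) = 2 ∧
      ∃ b : Module.Basis (Fin 2) (ZMod 2) (SteenrodHomology.AnnCoinvariants 4 38),
        b 0 = SteenrodHomology.annClass 4 38
          (SteenrodHomology.dpMonomial 4 38 ![0, 0, 7, 31]) h₁ ∧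
        b 1 = SteenrodHomology.annClass 4 38 SteenrodHomology.zetaTilde h₂ := by
  let b := Module.Basis.mk SteenrodHomology.linearIndependent_annClass
    (SteenrodHomology.span_annClass_eq_top.ge.trans <| Submodule.span_mono <|
      Set.insert_subset ⟨0, rfl⟩ <| Set.singleton_subset_iff.2 ⟨1, rfl⟩)
  refine ⟨SteenrodHomology.spike_mem, SteenrodHomology.zetaTilde_mem, ?_, b, ?_, ?_⟩
  · rw [Module.finrank_eq_card_basis b, Fintype.card_fin]
  · exact Module.Basis.mk_apply _ _ 0
  · exact Module.Basis.mk_apply _ _ 1
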